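/- Let $X$ be a Riemann surface, i.e. a connected Hausdorff complex manifold of dimension $1$ (second countability is not assumed), and let $K\subset X$ be a sub-surface with smooth boundary, not necessarily compact, closed or connected: every point $p\in K$ either lies in the topological interior $\mathring K$ of $K$, or has an open neighbourhood $U$ in $X$ with $K\cap U=\{\rho\le 0\}$ for some smooth function $\rho:U\to\mathbb R$ with $d\rho_p\neq 0$. Write $\partial K=K\setminus\mathring K$ and assume that $\partial K\neq\emptyset$. Call a real function on an open subset $W$ of $X$ harmonic if it is continuous and, for every holomorphic chart $\varphi:U\to\mathbb C$ with $U\subset W$ open and $\overline{\mathbb D}\subset\varphi(U)$, its value at $\varphi^{-1}(0)$ equals its mean $\frac1{2\pi}\int_0^{2\pi}u(\varphi^{-1}(e^{it}))\,dt$ over the circle $\varphi^{-1}(S^1)$. Then for every $x_0\in\mathring K$ there exists a continuous function $G:K\setminus\{x_0\}\to[0,\infty)$ which is harmonic on the interior of $K\setminus\{x_0\}$, vanishes on $\partial K$, and has a logarithmic pole at $x_0$: for every local holomorphic coordinate $\xi$ centred at $x_0$, the function $G+\log|\xi|$ extends over $x_0$ to a harmonic function on a neighbourhood of $x_0$. 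-/

import Mathlib

open scoped Manifold ContDiff

/-- A holomorphic coordinate on an open part of the Riemann surface `X`: a chart in the maximal
holomorphic atlas. -/
def IsHolomorphicChart {X : Type*} [TopologicalSpace X] [ChartedSpace ℂ X]
    (φ : OpenPartialHomeomorph X ℂ) : Prop :=
  φ ∈ IsManifold.maximalAtlas 𝓘(ℂ) ω X

/-- `K` is a sub-surface with smooth boundary (an embedded codimension zero submanifold with
boundary): near each of its points that is not interior, `K` is the sublevel set `{ρ ≤ 0}` of a
smooth real function `ρ` with non-vanishing differential. (Then `ρ` vanishes at the point.) -/
def IsSubsurfaceWithSmoothBoundary {X : Type*} [TopologicalSpace X] [ChartedSpace ℂ X]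
    (K : Set X) : Prop :=
  ∀ p ∈ K, p ∉ interior K →
    ∃ (φ : OpenPartialHomeomorph X ℂ) (ρ : ℂ → ℝ),
      IsHolomorphicChart φ ∧ p ∈ φ.source ∧
      ContDiffOn ℝ ∞ ρ φ.target ∧ fderiv ℝ ρ (φ p) ≠ 0 ∧
      ∀ x ∈ φ.source, (x ∈ K ↔ ρ (φ x) ≤ 0)

/-- The boundary `∂K` of a sub-surface with boundary: the points of `K` that are not interior. -/
def subsurfaceBoundary {X : Type*} [TopologicalSpace X] (K : Set X) : Set X :=
  K \ interior K

/-- `u` is harmonic on the open set `W`: it is continuous there, and for every disk in `W`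
(the preimage of the unit disk under a holomorphic chart `φ` with domain in `W` whose image
contains the closed unit disk) its value at the centre is its mean over the boundary circle. -/
def IsHarmonicOn {X : Type*} [TopologicalSpace X] [ChartedSpace ℂ X]
    (u : X → ℝ) (W : Set X) : Prop :=
  ContinuousOn u W ∧
    ∀ φ : OpenPartialHomeomorph X ℂ, IsHolomorphicChart φ → φ.source ⊆ W →
      Metric.closedBall (0 : ℂ) 1 ⊆ φ.target →
      Real.circleAverage (fun z => u (φ.symm z)) 0 1 = u (φ.symm 0)

/-- `G` has a logarithmic pole at `x₀`: for every holomorphic coordinate `ξ` centred at `x₀`, the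
function `G + log |ξ|` (extended over `x₀`) is harmonic on a neighbourhood of `x₀`. -/
def HasLogarithmicPole {X : Type*} [TopologicalSpace X] [ChartedSpace ℂ X]
    (G : X → ℝ) (x₀ : X) : Prop :=
  ∀ ξ : OpenPartialHomeomorph X ℂ, IsHolomorphicChart ξ → x₀ ∈ ξ.source → ξ x₀ = 0 →
    ∃ (V : Set X) (H : X → ℝ), IsOpen V ∧ x₀ ∈ V ∧ V ⊆ ξ.source ∧ IsHarmonicOn H V ∧
      ∀ x ∈ V \ {x₀}, H x = G x + Real.log ‖ξ x‖

open Complex Metric Set Filter Topology Real InnerProductSpace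

/-! Perron's method. Let Y be the interior of K and φ a chart centred at x₀ with domain in Y and the
closed unit disk in its image. The function G is the upper envelope of the nonnegative, compactly
supported functions that vanish off Y, are subharmonic away from x₀ and grow there at most like
-log|φ|. Compact support makes the maximum principle available although X need not be compact, and
no countable base is used anywhere. Harmonicity of the envelope follows from Harnack's inequality
and a Dini-type compactness argument.

The crux is that the envelope is finite (`exists_green_bound`). A smooth boundary point provides a
nonempty open set D missing K, on which all competitors vanish. As X is connected, a quantitative
strong maximum principle carries this to the pole: there is a θ in [0,1) such that functions
subharmonic and at most 1 off the half disk, and nonpositive on D, are at most θ on the unit circle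
(`exists_contraction`). If μ is the maximum of a competitor v on the unit circle, comparison with
-log|φ| gives v ≤ μ + log 2 on the circle of radius 1/2, hence also outside it. Contraction then
yields μ ≤ θ(μ + log 2), which bounds μ independently of v.

Near x₀ the sum G + log|φ| is therefore bounded above. It is bounded below because the Green
function of the disk is a competitor, so the singularity is removable
(`hasLogarithmicPole_of_bounded`). At ∂K the logarithmic barrier of an exterior tangent disk
squeezes G to zero (`tendsto_greenFunction_boundary`). -/

/-- The Poisson integral over the unit circle. -/
noncomputable def diskPoisson (g : ℂ → ℝ) (w : ℂ) : ℝ :=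
  circleAverage (poissonKernel 0 w • g) 0 1

/-! ### The Poisson integral on the unit disk and its boundary values. -/

section Poisson

variable {g g₁ g₂ : ℂ → ℝ} {w : ℂ}

lemma continuousOn_poissonKernel_sphere (hw : w ∈ ball (0 : ℂ) 1) :
    ContinuousOn (poissonKernel 0 w) (sphere 0 1) := by
  rw [poissonKernel_eq_re_herglotzRieszKernel]
  have := continuousOn_herglotzRieszKernel_sphere hw
  rw [abs_one] at this
  exact continuous_re.comp_continuousOn this

lemma circleIntegrable_poissonKernel_smul (hg : ContinuousOn g (sphere 0 1))
    (hw : w ∈ ball (0 : ℂ) 1) : CircleIntegrable (poissonKernel 0 w • g) 0 1 :=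
  ((continuousOn_poissonKernel_sphere hw).smul hg).circleIntegrable zero_le_one

lemma harmonicAt_diskPoisson (hg : ContinuousOn g (sphere 0 1)) (hw : w ∈ ball (0 : ℂ) 1) :
    HarmonicAt (diskPoisson g) w := by
  have hgi : CircleIntegrable g 0 1 := hg.circleIntegrable zero_le_one
  have hgc : CircleIntegrable (fun ζ ↦ (g ζ : ℂ)) 0 1 :=
    (continuous_ofReal.comp_continuousOn hg).circleIntegrable zero_le_one
  refine (harmonicAt_congr_nhds ?_).2
    (analyticOnNhd_circleAverage_herglotzRieszKernel_smul hgc w hw).harmonicAt_re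
  filter_upwards [isOpen_ball.mem_nhds hw] with z hz
  rw [re_circleAverage_herglotzRieszKernel_smul hgi hz, ← poissonKernel_eq_re_herglotzRieszKernel,
    diskPoisson]

lemma diskPoisson_zero : diskPoisson g 0 = circleAverage g 0 1 := by
  refine circleAverage_congr_sphere fun z hz ↦ ?_
  have : ‖z‖ = 1 := by simpa using hz
  simp [poissonKernel_def, this]

lemma poissonKernel_le (hw : w ∈ ball (0 : ℂ) 1) {z : ℂ} (hz : z ∈ sphere (0 : ℂ) 1) :
    poissonKernel 0 w z ≤ (1 + ‖w‖) / (1 - ‖w‖) := by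
  rw [poissonKernel_eq_re_herglotzRieszKernel]
  simpa [herglotzRieszKernel_def] using re_herglotzRieszKernel_le hz hw

lemma le_poissonKernel (hw : w ∈ ball (0 : ℂ) 1) {z : ℂ} (hz : z ∈ sphere (0 : ℂ) 1) :
    (1 - ‖w‖) / (1 + ‖w‖) ≤ poissonKernel 0 w z := by
  rw [poissonKernel_eq_re_herglotzRieszKernel]
  simpa [herglotzRieszKernel_def] using le_re_herglotzRieszKernel hz hw

lemma poissonKernel_nonneg (hw : w ∈ ball (0 : ℂ) 1) {z : ℂ} (hz : z ∈ sphere (0 : ℂ) 1) :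
    0 ≤ poissonKernel 0 w z := by
  have : ‖w‖ < 1 := by simpa using hw
  exact (div_nonneg (by linarith) (by positivity)).trans (le_poissonKernel hw hz)

lemma diskPoisson_mono (h₁ : ContinuousOn g₁ (sphere 0 1)) (h₂ : ContinuousOn g₂ (sphere 0 1))
    (hw : w ∈ ball (0 : ℂ) 1) (h : ∀ z ∈ sphere (0 : ℂ) 1, g₁ z ≤ g₂ z) :
    diskPoisson g₁ w ≤ diskPoisson g₂ w := by
  refine circleAverage_mono (circleIntegrable_poissonKernel_smul h₁ hw)
    (circleIntegrable_poissonKernel_smul h₂ hw) fun z hz ↦ ?_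
  rw [abs_one] at hz
  exact mul_le_mul_of_nonneg_left (h z hz) (poissonKernel_nonneg hw hz)

lemma diskPoisson_harmonic (hg : HarmonicOnNhd g (closedBall 0 1)) (hw : w ∈ ball (0 : ℂ) 1) :
    diskPoisson g w = g w :=
  hg.circleAverage_poissonKernel_smul hw

lemma diskPoisson_const (a : ℝ) (hw : w ∈ ball (0 : ℂ) 1) : diskPoisson (fun _ ↦ a) w = a :=
  diskPoisson_harmonic (harmonicOnNhd_const a) hw

lemma diskPoisson_neg : diskPoisson (-g) w = - diskPoisson g w := by
  have : poissonKernel 0 w • (-g) = (-1 : ℝ) • (poissonKernel 0 w • g) := by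
    ext; simp
  rw [diskPoisson, this, circleAverage_smul]
  simp [diskPoisson]

lemma diskPoisson_le_harnack (hg : ContinuousOn g (sphere 0 1)) (hw : w ∈ ball (0 : ℂ) 1)
    (h : ∀ z ∈ sphere (0 : ℂ) 1, 0 ≤ g z) :
    diskPoisson g w ≤ (1 + ‖w‖) / (1 - ‖w‖) * diskPoisson g 0 := by
  rw [diskPoisson_zero, ← smul_eq_mul, ← circleAverage_fun_smul]
  refine circleAverage_mono (circleIntegrable_poissonKernel_smul hg hw)
    ((continuousOn_const.mul hg).circleIntegrable zero_le_one) fun z hz ↦ ?_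
  rw [abs_one] at hz
  exact mul_le_mul_of_nonneg_right (poissonKernel_le hw hz) (h z hz)

lemma harnack_le_diskPoisson (hg : ContinuousOn g (sphere 0 1)) (hw : w ∈ ball (0 : ℂ) 1)
    (h : ∀ z ∈ sphere (0 : ℂ) 1, 0 ≤ g z) :
    (1 - ‖w‖) / (1 + ‖w‖) * diskPoisson g 0 ≤ diskPoisson g w := by
  rw [diskPoisson_zero, ← smul_eq_mul, ← circleAverage_fun_smul]
  refine circleAverage_mono ((continuousOn_const.mul hg).circleIntegrable zero_le_one)
    (circleIntegrable_poissonKernel_smul hg hw) fun z hz ↦ ?_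
  rw [abs_one] at hz
  exact mul_le_mul_of_nonneg_right (le_poissonKernel hw hz) (h z hz)

/-- On the circle the squared distance to ζ agrees with the real part of an affine function, which
is harmonic; this supplies harmonic majorants that touch at ζ. -/
lemma norm_sub_sq_eq_of_mem_sphere {z ζ : ℂ} (hz : z ∈ sphere (0 : ℂ) 1)
    (hζ : ζ ∈ sphere (0 : ℂ) 1) : ‖z - ζ‖ ^ 2 = (2 - 2 * (starRingEnd ℂ ζ * z)).re := by
  have h₁ : ‖z‖ ^ 2 = 1 := by rw [mem_sphere_zero_iff_norm.1 hz, one_pow]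
  have h₂ : ‖ζ‖ ^ 2 = 1 := by rw [mem_sphere_zero_iff_norm.1 hζ, one_pow]
  rw [← normSq_eq_norm_sq, normSq_apply] at *
  simp
  nlinarith

/-- One half of the attainment of boundary values. -/
lemma eventually_diskPoisson_lt (hg : ContinuousOn g (sphere 0 1)) {ζ : ℂ}
    (hζ : ζ ∈ sphere (0 : ℂ) 1) {b : ℝ} (hb : g ζ < b) :
    ∀ᶠ w in 𝓝[ball 0 1] ζ, diskPoisson g w < b := by
  obtain ⟨a, ha, hab⟩ := exists_between hb
  obtain ⟨δ, hδ, hgδ⟩ : ∃ δ > 0, ∀ z ∈ sphere (0 : ℂ) 1, dist z ζ < δ → g z < a := by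
    have := (hg ζ hζ).eventually (gt_mem_nhds ha)
    obtain ⟨δ, hδ, h⟩ := Metric.mem_nhdsWithin_iff.1 this
    exact ⟨δ, hδ, fun z hz hd ↦ h ⟨hd, hz⟩⟩
  obtain ⟨M, hM⟩ := (isCompact_sphere (0 : ℂ) 1).bddAbove_image hg
  -- At distance at least δ from ζ the term N‖z - ζ‖² is at least |M| + |a|, enough to lift a above
  -- the bound M of g.
  set N := (|M| + |a|) / δ ^ 2
  have hN : 0 ≤ N := by positivity
  set h : ℂ → ℝ := fun z ↦ ((a : ℂ) + N * (2 - 2 * (starRingEnd ℂ ζ * z))).re with hh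
  have hharm : HarmonicOnNhd h (closedBall 0 1) := fun z _ ↦
    AnalyticAt.harmonicAt_re (f := fun z ↦ (a : ℂ) + N * (2 - 2 * (starRingEnd ℂ ζ * z)))
      (by fun_prop)
  have hcont : Continuous h := by fun_prop
  have hle : ∀ z ∈ sphere (0 : ℂ) 1, g z ≤ h z := by
    intro z hz
    have e : h z = a + N * ‖z - ζ‖ ^ 2 := by
      rw [norm_sub_sq_eq_of_mem_sphere hz hζ, hh]
      simp only [add_re, ofReal_re, re_ofReal_mul]
    rw [e]
    by_cases hd : dist z ζ < δ
    · have := hgδ z hz hd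
      nlinarith [mul_nonneg hN (sq_nonneg ‖z - ζ‖)]
    · rw [not_lt, dist_eq_norm] at hd
      have h1 : g z ≤ M := hM (mem_image_of_mem g hz)
      have h2 : N * δ ^ 2 = |M| + |a| := by simp only [N]; field_simp
      have h3 : N * δ ^ 2 ≤ N * ‖z - ζ‖ ^ 2 := by gcongr
      linarith [le_abs_self M, neg_abs_le a]
  have hζa : h ζ = a := by
    have h₂ : starRingEnd ℂ ζ * ζ = 1 := by
      rw [← normSq_eq_conj_mul_self, normSq_eq_norm_sq, mem_sphere_zero_iff_norm.1 hζ]; simp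
    simp only [hh, h₂]
    simp
  have hlt : ∀ᶠ w in 𝓝[ball 0 1] ζ, h w < b :=
    (hcont.continuousAt.eventually (gt_mem_nhds (by rw [hζa]; exact hab))).filter_mono
      nhdsWithin_le_nhds
  filter_upwards [hlt, self_mem_nhdsWithin] with w hw hwb
  exact ((diskPoisson_mono hg hcont.continuousOn hwb hle).trans_eq
    (diskPoisson_harmonic hharm hwb)).trans_lt hw

lemma tendsto_diskPoisson (hg : ContinuousOn g (sphere 0 1)) {ζ : ℂ}
    (hζ : ζ ∈ sphere (0 : ℂ) 1) : Tendsto (diskPoisson g) (𝓝[ball 0 1] ζ) (𝓝 (g ζ)) := by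
  refine tendsto_order.2 ⟨fun a ha ↦ ?_, fun b hb ↦ eventually_diskPoisson_lt hg hζ hb⟩
  have := eventually_diskPoisson_lt hg.neg hζ (b := -a) (by simpa using ha)
  filter_upwards [this] with w hw
  rw [diskPoisson_neg] at hw
  linarith

open Classical in
/-- The function `g` with its values in the unit disk replaced by its Poisson integral. -/
noncomputable def diskExtend (g : ℂ → ℝ) (w : ℂ) : ℝ :=
  if w ∈ ball (0 : ℂ) 1 then diskPoisson g w else g w

lemma diskExtend_of_mem (hw : w ∈ ball (0 : ℂ) 1) : diskExtend g w = diskPoisson g w :=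
  if_pos hw

lemma diskExtend_of_notMem (hw : w ∉ ball (0 : ℂ) 1) : diskExtend g w = g w :=
  if_neg hw

lemma harmonicAt_diskExtend (hg : ContinuousOn g (sphere 0 1)) (hw : w ∈ ball (0 : ℂ) 1) :
    HarmonicAt (diskExtend g) w :=
  (harmonicAt_congr_nhds (by
    filter_upwards [isOpen_ball.mem_nhds hw] with z hz using diskExtend_of_mem hz)).2
    (harmonicAt_diskPoisson hg hw)

/-- Continuity is checked separately along the ball, where the Poisson integral attains its boundary
values, and along its complement, where nothing has changed. -/
lemma continuousWithinAt_diskExtend {t : Set ℂ} (hg : ContinuousOn g (sphere 0 1))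
    (hw : w ∉ ball (0 : ℂ) 1 → ContinuousWithinAt g t w) :
    ContinuousWithinAt (diskExtend g) t w := by
  by_cases hb : w ∈ ball (0 : ℂ) 1
  · exact (harmonicAt_diskExtend hg hb).1.continuousAt.continuousWithinAt
  have h1 : Tendsto (diskExtend g) (𝓝[t ∩ (ball 0 1)ᶜ] w) (𝓝 (diskExtend g w)) := by
    rw [diskExtend_of_notMem hb]
    refine Tendsto.congr' ?_ ((hw hb).mono_left (nhdsWithin_mono _ inter_subset_left))
    filter_upwards [self_mem_nhdsWithin] with z hz using (diskExtend_of_notMem hz.2).symm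
  have h2 : Tendsto (diskExtend g) (𝓝[t ∩ ball 0 1] w) (𝓝 (diskExtend g w)) := by
    refine Tendsto.mono_left ?_ (nhdsWithin_mono _ inter_subset_right)
    by_cases hs : w ∈ sphere (0 : ℂ) 1
    · rw [diskExtend_of_notMem hb]
      refine (tendsto_diskPoisson hg hs).congr' ?_
      filter_upwards [self_mem_nhdsWithin] with z hz using (diskExtend_of_mem hz).symm
    · have : w ∉ closure (ball (0 : ℂ) 1) := by
        rw [closure_ball _ one_ne_zero, ← ball_union_sphere]
        exact fun h ↦ h.elim hb hs
      rw [notMem_closure_iff_nhdsWithin_eq_bot.1 this]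
      exact tendsto_bot
  have := h2.sup h1
  rwa [← nhdsWithin_union, inter_union_compl] at this

end Poisson

/-! ### Holomorphic charts and affine rescaling. -/

section Charts

variable {X : Type*} [TopologicalSpace X] [ChartedSpace ℂ X]
  {φ ψ : OpenPartialHomeomorph X ℂ} {W : Set X} {x : X}

lemma IsHolomorphicChart.analyticAt_comp_symm (hφ : IsHolomorphicChart φ)
    (hψ : IsHolomorphicChart ψ) {z : ℂ} (hz : z ∈ ψ.target) (hz' : ψ.symm z ∈ φ.source) :
    AnalyticAt ℂ (φ ∘ ψ.symm) z := by
  have h₁ := contMDiffAt_symm_of_mem_maximalAtlas hψ hz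
  have h₂ := contMDiffAt_of_mem_maximalAtlas hφ hz'
  exact (contMDiffAt_iff_contDiffAt.1 (h₂.comp z h₁)).analyticAt

variable [IsManifold 𝓘(ℂ) ω X]

lemma isHolomorphicChart_chartAt (x : X) : IsHolomorphicChart (chartAt ℂ x) :=
  IsManifold.chart_mem_maximalAtlas x

/-- `IsHarmonicOn` tests only unit disks of charts; an affine change of coordinate turns every
closed disk inside a chart into such a unit disk. -/
lemma exists_scaled_chart (hφ : IsHolomorphicChart φ) {c : ℂ} {r : ℝ} (hr : 0 < r)
    (hW : IsOpen W) (hc : closedBall c r ⊆ φ.target) (hcW : ∀ z ∈ closedBall c r, φ.symm z ∈ W) :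
    ∃ ψ : OpenPartialHomeomorph X ℂ, IsHolomorphicChart ψ ∧ ψ.source = φ.source ∩ W ∧
      closedBall 0 1 ⊆ ψ.target ∧ (∀ y, ψ y = (r : ℂ)⁻¹ * (φ y - c)) ∧
      ∀ z, ψ.symm z = φ.symm (r * z + c) := by
  have hr' : (r : ℂ) ≠ 0 := by exact_mod_cast hr.ne'
  let e : ℂ ≃ₜ ℂ :=
    (Homeomorph.addRight (-c)).trans (Homeomorph.mulLeft₀ (r : ℂ)⁻¹ (inv_ne_zero hr'))
  have he : ∀ y, e y = (r : ℂ)⁻¹ * (y - c) := fun y ↦ by simp [e, sub_eq_add_neg]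
  have hes : ∀ z, e.symm z = r * z + c := fun z ↦ by
    rw [Homeomorph.symm_apply_eq, he]; field_simp; ring
  have hsrc : ((φ.transHomeomorph e).restr W).source = φ.source ∩ W := by
    simp [hW.interior_eq]
  refine ⟨(φ.transHomeomorph e).restr W, ?_, hsrc, ?_, ?_, ?_⟩
  · refine OpenPartialHomeomorph.mem_maximalAtlas_of_contMDiffOn (I := 𝓘(ℂ)) (n := ω) _ ?_ ?_
    · rw [hsrc]
      have h1 : ContMDiff 𝓘(ℂ) 𝓘(ℂ) ω (e : ℂ → ℂ) := by
        have : (e : ℂ → ℂ) = fun y ↦ (r : ℂ)⁻¹ * (y - c) := funext he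
        rw [contMDiff_iff_contDiff, this]
        fun_prop
      exact h1.comp_contMDiffOn ((contMDiffOn_of_mem_maximalAtlas hφ).mono inter_subset_left)
    · have h1 : ContMDiff 𝓘(ℂ) 𝓘(ℂ) ω (e.symm : ℂ → ℂ) := by
        have : (e.symm : ℂ → ℂ) = fun y ↦ (r : ℂ) * y + c := funext hes
        rw [contMDiff_iff_contDiff, this]
        fun_prop
      refine (contMDiffOn_symm_of_mem_maximalAtlas hφ).comp h1.contMDiffOn ?_
      intro z hz
      have := hz.1
      simpa using this
  · intro z hz
    have h1 : (r : ℂ) * z + c ∈ closedBall c r := by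
      have : ‖z‖ ≤ 1 := by simpa using hz
      simp [abs_of_pos hr, mul_le_of_le_one_right hr.le this]
    have h2 := hc h1
    have h3 := hcW _ h1
    simp only [OpenPartialHomeomorph.restr_target, OpenPartialHomeomorph.transHomeomorph_target,
      OpenPartialHomeomorph.transHomeomorph_symm_apply, hW.interior_eq]
    simp only [mem_inter_iff, mem_preimage, hes, Function.comp_apply]
    exact ⟨h2, h3⟩
  · intro y
    simp [he]
  · intro z
    simp [hes]

lemma exists_disk_chart (hφ : IsHolomorphicChart φ) (hx : x ∈ φ.source) (hW : W ∈ 𝓝 x) :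
    ∃ r : ℝ, 0 < r ∧ ∃ ψ : OpenPartialHomeomorph X ℂ, IsHolomorphicChart ψ ∧ x ∈ ψ.source ∧
      ψ.source ⊆ φ.source ∩ W ∧ closedBall 0 1 ⊆ ψ.target ∧
      (∀ y, ψ y = (r : ℂ)⁻¹ * (φ y - φ x)) ∧ ∀ z, ψ.symm z = φ.symm (r * z + φ x) := by
  have h : φ.target ∩ φ.symm ⁻¹' interior W ∈ 𝓝 (φ x) := by
    refine inter_mem (φ.open_target.mem_nhds (φ.map_source hx)) ?_
    refine (φ.continuousAt_symm (φ.map_source hx)).preimage_mem_nhds ?_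
    rw [φ.left_inv hx]
    exact interior_mem_nhds.2 hW
  obtain ⟨r, hr, hrs⟩ := Metric.nhds_basis_closedBall.mem_iff.1 h
  obtain ⟨ψ, h1, h2, h3, h4, h5⟩ := exists_scaled_chart hφ hr isOpen_interior
    (fun z hz ↦ (hrs hz).1) (fun z hz ↦ (hrs hz).2)
  refine ⟨r, hr, ψ, h1, ?_, ?_, h3, h4, h5⟩
  · rw [h2]
    exact ⟨hx, mem_interior_iff_mem_nhds.2 hW⟩
  · rw [h2]
    exact inter_subset_inter_right _ interior_subset

lemma exists_disk_chart_at (x : X) (hW : W ∈ 𝓝 x) :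
    ∃ ψ : OpenPartialHomeomorph X ℂ, IsHolomorphicChart ψ ∧ x ∈ ψ.source ∧ ψ.source ⊆ W ∧
      closedBall 0 1 ⊆ ψ.target ∧ ψ x = 0 := by
  obtain ⟨r, hr, ψ, h1, h2, h3, h4, h5, -⟩ :=
    exists_disk_chart (isHolomorphicChart_chartAt x) (mem_chart_source ℂ x) hW
  exact ⟨ψ, h1, h2, h3.trans inter_subset_right, h4, by simp [h5]⟩

end Charts

lemma continuousOn_comp_symm_of_continuousAt {X : Type*} [TopologicalSpace X]
    {φ : OpenPartialHomeomorph X ℂ} {v : X → ℝ} {s : Set ℂ}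
    (hs : ∀ z ∈ s, z ∈ φ.target ∧ ContinuousAt v (φ.symm z)) : ContinuousOn (v ∘ φ.symm) s :=
  fun z hz ↦ ((hs z hz).2.comp (φ.continuousAt_symm (hs z hz).1)).continuousWithinAt

lemma eventually_circle_of_eventually {X : Type*} [TopologicalSpace X]
    {φ : OpenPartialHomeomorph X ℂ} {x : X} {P : X → Prop} (hP : ∀ᶠ y in 𝓝 x, P y)
    (hx : x ∈ φ.source) :
    ∀ᶠ r in 𝓝[>] (0 : ℝ), 0 < r ∧ ∀ z ∈ closedBall (φ x) r, z ∈ φ.target ∧ P (φ.symm z) := by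
  have h : ∀ᶠ z in 𝓝 (φ x), z ∈ φ.target ∧ P (φ.symm z) := by
    refine (φ.open_target.eventually_mem (φ.map_source hx)).and ?_
    have := φ.continuousAt_symm (φ.map_source hx)
    rw [ContinuousAt, φ.left_inv hx] at this
    exact this.eventually hP
  obtain ⟨R, hR, hRs⟩ := Metric.nhds_basis_closedBall.mem_iff.1 h
  filter_upwards [Ioc_mem_nhdsGT hR] with r hr
  exact ⟨hr.1, fun z hz ↦ hRs (closedBall_subset_closedBall hr.2 hz)⟩

lemma eventually_circleIntegrable {X : Type*} [TopologicalSpace X]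
    {φ : OpenPartialHomeomorph X ℂ} {x : X} {v : X → ℝ} (hv : ∀ᶠ y in 𝓝 x, ContinuousAt v y)
    (hx : x ∈ φ.source) :
    ∀ᶠ r in 𝓝[>] (0 : ℝ), CircleIntegrable (v ∘ φ.symm) (φ x) r := by
  filter_upwards [eventually_circle_of_eventually hv hx] with r hr
  exact ((continuousOn_comp_symm_of_continuousAt hr.2).mono
    sphere_subset_closedBall).circleIntegrable hr.1.le

/-! ### Local harmonicity and subharmonicity. -/

section Harmonic

variable {X : Type*} [TopologicalSpace X] [ChartedSpace ℂ X]

/-- `h` is harmonic near `x`, as seen in every holomorphic chart. -/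
def HarmonicNear (h : X → ℝ) (x : X) : Prop :=
  ∀ φ : OpenPartialHomeomorph X ℂ, IsHolomorphicChart φ → x ∈ φ.source →
    HarmonicAt (h ∘ φ.symm) (φ x)

/-- `v` is continuous near `x` and satisfies the sub-mean value property at `x` on all small
circles of every holomorphic chart. -/
def SubharmonicAt (v : X → ℝ) (x : X) : Prop :=
  (∀ᶠ y in 𝓝 x, ContinuousAt v y) ∧
    ∀ φ : OpenPartialHomeomorph X ℂ, IsHolomorphicChart φ → x ∈ φ.source →
      ∀ᶠ r in 𝓝[>] (0 : ℝ), v x ≤ circleAverage (v ∘ φ.symm) (φ x) r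

variable {φ : OpenPartialHomeomorph X ℂ} {W : Set X} {x : X} {u v h : X → ℝ}

lemma SubharmonicAt.continuousAt (hv : SubharmonicAt v x) : ContinuousAt v x :=
  hv.1.self_of_nhds

lemma SubharmonicAt.add (hu : SubharmonicAt u x) (hv : SubharmonicAt v x) :
    SubharmonicAt (u + v) x := by
  refine ⟨(hu.1.and hv.1).mono fun y hy ↦ hy.1.add hy.2, fun φ hφ hx ↦ ?_⟩
  filter_upwards [hu.2 φ hφ hx, hv.2 φ hφ hx, eventually_circleIntegrable hu.1 hx,
    eventually_circleIntegrable hv.1 hx] with r h1 h2 h3 h4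
  have : (u + v) ∘ φ.symm = u ∘ φ.symm + v ∘ φ.symm := rfl
  rw [this, circleAverage_add h3 h4]
  exact add_le_add h1 h2

lemma SubharmonicAt.const_smul {c : ℝ} (hc : 0 ≤ c) (hv : SubharmonicAt v x) :
    SubharmonicAt (c • v) x := by
  refine ⟨hv.1.mono fun y hy ↦ hy.const_smul c, fun φ hφ hx ↦ ?_⟩
  filter_upwards [hv.2 φ hφ hx] with r h1
  have : (c • v) ∘ φ.symm = c • (v ∘ φ.symm) := rfl
  rw [this, circleAverage_smul]
  exact mul_le_mul_of_nonneg_left h1 hc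

/-- The sub-mean value property passes to a function that is at least `v` and touches it. -/
lemma SubharmonicAt.of_le (hv : SubharmonicAt v x) (hu : ∀ᶠ y in 𝓝 x, ContinuousAt u y)
    (hx : u x = v x) (hle : ∀ᶠ y in 𝓝 x, v y ≤ u y) : SubharmonicAt u x := by
  refine ⟨hu, fun φ hφ hxs ↦ ?_⟩
  filter_upwards [hv.2 φ hφ hxs, eventually_circleIntegrable hu hxs,
    eventually_circleIntegrable hv.1 hxs, eventually_circle_of_eventually hle hxs]
    with r h1 h2 h3 h4
  rw [hx]
  refine h1.trans (circleAverage_mono h3 h2 fun z hz ↦ ?_)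
  rw [abs_of_pos h4.1] at hz
  exact (h4.2 z (sphere_subset_closedBall hz)).2

lemma subharmonicAt_const (c : ℝ) : SubharmonicAt (fun _ : X ↦ c) x :=
  ⟨Eventually.of_forall fun _ ↦ continuousAt_const, fun φ _ _ ↦ Eventually.of_forall fun r ↦
    (circleAverage_const c (φ x) r).ge⟩

lemma SubharmonicAt.sub_const (hv : SubharmonicAt v x) (c : ℝ) :
    SubharmonicAt (fun y ↦ v y - c) x := by
  simp only [sub_eq_add_neg]
  exact hv.add (subharmonicAt_const (-c))

/-- At x the maximum is touched from below by whichever function is larger there. -/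
lemma SubharmonicAt.sup (hu : SubharmonicAt u x) (hv : SubharmonicAt v x) :
    SubharmonicAt (u ⊔ v) x := by
  have hc : ∀ᶠ y in 𝓝 x, ContinuousAt (u ⊔ v) y := (hu.1.and hv.1).mono fun y hy ↦ hy.1.sup hy.2
  rcases le_total (u x) (v x) with h | h
  · exact hv.of_le hc (sup_eq_right.2 h) (Eventually.of_forall fun y ↦ le_sup_right)
  · exact hu.of_le hc (sup_eq_left.2 h) (Eventually.of_forall fun y ↦ le_sup_left)

lemma SubharmonicAt.congr (hv : SubharmonicAt v x) (h : ∀ᶠ y in 𝓝 x, u y = v y) :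
    SubharmonicAt u x :=
  hv.of_le (by
    filter_upwards [hv.1, h.eventually_nhds] with y h1 h2
    exact h1.congr (h2.mono fun _ ↦ Eq.symm)) h.self_of_nhds (h.mono fun _ ↦ ge_of_eq)

lemma HarmonicNear.neg (hh : HarmonicNear h x) : HarmonicNear (-h) x :=
  fun φ hφ hx ↦ (hh φ hφ hx).neg

lemma HarmonicNear.add (hu : HarmonicNear u x) (hv : HarmonicNear v x) :
    HarmonicNear (u + v) x :=
  fun φ hφ hx ↦ (hu φ hφ hx).add (hv φ hφ hx)

lemma HarmonicNear.congr (hh : HarmonicNear h x) (he : ∀ᶠ y in 𝓝 x, u y = h y) :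
    HarmonicNear u x := by
  intro φ hφ hx
  refine (harmonicAt_congr_nhds ?_).2 (hh φ hφ hx)
  have := φ.continuousAt_symm (φ.map_source hx)
  rw [ContinuousAt, φ.left_inv hx] at this
  exact this.eventually he

lemma IsHarmonicOn.neg (hu : IsHarmonicOn u W) : IsHarmonicOn (-u) W := by
  refine ⟨hu.1.neg, fun φ hφ hφW hb ↦ ?_⟩
  have : (fun z ↦ (-u) (φ.symm z)) = (-1 : ℝ) • (fun z ↦ u (φ.symm z)) := by ext; simp
  rw [this, circleAverage_smul, hu.2 φ hφ hφW hb]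
  simp

/-- Near p z the function f is the real part of a holomorphic F, so f ∘ p is locally the real part
of F ∘ p. Harmonicity thus does not depend on the chart. -/
lemma harmonicAt_comp_analyticAt {f : ℂ → ℝ} {p : ℂ → ℂ} {z : ℂ} (hf : HarmonicAt f (p z))
    (hp : AnalyticAt ℂ p z) : HarmonicAt (f ∘ p) z := by
  obtain ⟨R, hR, hRf⟩ := Metric.eventually_nhds_iff_ball.1 hf.eventually
  obtain ⟨F, hF, hFf⟩ := HarmonicOnNhd.exists_analyticOnNhd_ball_re_eq (f := f) hRf
  refine (harmonicAt_congr_nhds ?_).2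
    (((hF (p z) (mem_ball_self hR)).comp hp).harmonicAt_re)
  filter_upwards [hp.continuousAt.preimage_mem_nhds (ball_mem_nhds _ hR)] with y hy
  exact (hFf hy).symm

lemma HarmonicAt.harmonicNear_comp {f : ℂ → ℝ} (hφ : IsHolomorphicChart φ) (hx : x ∈ φ.source)
    (hf : HarmonicAt f (φ x)) : HarmonicNear (f ∘ φ) x := by
  intro ψ hψ hxψ
  have := hφ.analyticAt_comp_symm hψ (ψ.map_source hxψ) (by rwa [ψ.left_inv hxψ])
  refine harmonicAt_comp_analyticAt (p := φ ∘ ψ.symm) ?_ this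
  simpa [ψ.left_inv hxψ] using hf

lemma harmonicNear_log_norm (hφ : IsHolomorphicChart φ) (hx : x ∈ φ.source) {c : ℂ}
    (hc : φ x ≠ c) : HarmonicNear (fun y ↦ Real.log ‖φ y - c‖) x :=
  HarmonicAt.harmonicNear_comp (f := fun z ↦ Real.log ‖z - c‖) hφ hx
    (AnalyticAt.harmonicAt_log_norm (f := fun z ↦ z - c) (by fun_prop) (sub_ne_zero.2 hc))

lemma HarmonicNear.of_chart (hφ : IsHolomorphicChart φ) (hx : x ∈ φ.source)
    (hh : HarmonicAt (h ∘ φ.symm) (φ x)) : HarmonicNear h x := by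
  refine (HarmonicAt.harmonicNear_comp hφ hx hh).congr ?_
  filter_upwards [φ.open_source.mem_nhds hx] with y hy
  simp [φ.left_inv hy]

variable [IsManifold 𝓘(ℂ) ω X]

lemma HarmonicNear.continuousAt (hh : HarmonicNear h x) : ContinuousAt h x := by
  have hx := mem_chart_source ℂ x
  have h1 := (hh _ (isHolomorphicChart_chartAt x) hx).1.continuousAt.comp
    ((chartAt ℂ x).continuousAt hx)
  refine h1.congr ?_
  filter_upwards [(chartAt ℂ x).open_source.mem_nhds hx] with y hy
  simp [(chartAt ℂ x).left_inv hy]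

lemma HarmonicNear.eventually (hh : HarmonicNear h x) : ∀ᶠ y in 𝓝 x, HarmonicNear h y := by
  have hx := mem_chart_source ℂ x
  have h1 := (hh _ (isHolomorphicChart_chartAt x) hx).eventually
  filter_upwards [((chartAt ℂ x).continuousAt hx).eventually h1,
    (chartAt ℂ x).open_source.mem_nhds hx] with y hy hys
  exact .of_chart (isHolomorphicChart_chartAt x) hys hy

lemma HarmonicNear.subharmonicAt (hh : HarmonicNear h x) : SubharmonicAt h x := by
  refine ⟨hh.eventually.mono fun y hy ↦ hy.continuousAt, fun φ hφ hx ↦ ?_⟩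
  filter_upwards [eventually_circle_of_eventually hh.eventually hx] with r hr
  rw [InnerProductSpace.HarmonicOnNhd.circleAverage_eq]
  · simp [φ.left_inv hx]
  · intro z hz
    rw [abs_of_pos hr.1] at hz
    obtain ⟨h1, h2⟩ := hr.2 z hz
    have := h2 φ hφ (φ.map_target h1)
    rwa [φ.right_inv h1] at this

lemma isHarmonicOn_of_harmonicNear (hh : ∀ x ∈ W, HarmonicNear h x) : IsHarmonicOn h W := by
  refine ⟨fun x hx ↦ (hh x hx).continuousAt.continuousWithinAt, fun φ hφ hφW hb ↦ ?_⟩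
  refine InnerProductSpace.HarmonicOnNhd.circleAverage_eq (f := h ∘ φ.symm) fun z hz ↦ ?_
  rw [abs_one] at hz
  have h1 := φ.map_target (hb hz)
  have := hh _ (hφW h1) φ hφ h1
  rwa [φ.right_inv (hb hz)] at this

/-- Rescaling converts the unit-disk mean value property into one for all small circles of a fixed
chart. Functions known only through mean values, such as the envelope, can then enter the maximum
principle. -/
lemma IsHarmonicOn.circleAverage_eventuallyEq (hu : IsHarmonicOn u W) (hW : IsOpen W)
    (hxW : x ∈ W) (hφ : IsHolomorphicChart φ) (hx : x ∈ φ.source) :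
    ∀ᶠ r in 𝓝[>] (0 : ℝ), circleAverage (u ∘ φ.symm) (φ x) r = u x := by
  filter_upwards [eventually_circle_of_eventually (hW.mem_nhds hxW) hx] with r hr
  obtain ⟨ψ, h1, h2, h3, h4, h5⟩ := exists_scaled_chart hφ hr.1 hW
    (fun z hz ↦ (hr.2 z hz).1) (fun z hz ↦ (hr.2 z hz).2)
  have := hu.2 ψ h1 (h2.trans_subset inter_subset_right) h3
  rw [circleAverage_eq_circleAverage_zero_one]
  simpa [h5, φ.left_inv hx] using this

lemma IsHarmonicOn.subharmonicAt (hu : IsHarmonicOn u W) (hW : IsOpen W) (hxW : x ∈ W) :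
    SubharmonicAt u x :=
  ⟨(hW.eventually_mem hxW).mono fun _ hy ↦ hu.1.continuousAt (hW.mem_nhds hy),
    fun _ hφ hx ↦ (hu.circleAverage_eventuallyEq hW hxW hφ hx).mono fun _ h ↦ h.ge⟩

end Harmonic

/-! ### The maximum principle. -/

section MaximumPrinciple

/-- By continuity, strict inequality at one point of the circle would make the mean strictly smaller
than m. -/
lemma eqOn_sphere_of_le_circleAverage {f : ℂ → ℝ} {c : ℂ} {r m : ℝ} (hr : 0 < r)
    (hf : ContinuousOn f (sphere c r)) (hle : ∀ z ∈ sphere c r, f z ≤ m)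
    (hge : m ≤ circleAverage f c r) : ∀ z ∈ sphere c r, f z = m := by
  intro z hz
  by_contra hne
  have hlt := (hle z hz).lt_of_ne hne
  obtain ⟨θ, hθ, rfl⟩ : z ∈ circleMap c r '' Ioc 0 (2 * π) := by
    rw [image_circleMap_Ioc, abs_of_pos hr]; exact hz
  have hc : Continuous fun θ ↦ f (circleMap c r θ) :=
    hf.comp_continuous (continuous_circleMap c r) fun θ ↦ circleMap_mem_sphere c hr.le θ
  have h1 := intervalIntegral.integral_lt_integral_of_continuousOn_of_le_of_exists_lt
    (f := fun θ ↦ f (circleMap c r θ)) (g := fun _ ↦ m) two_pi_pos hc.continuousOn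
    continuousOn_const (fun θ _ ↦ hle _ (circleMap_mem_sphere c hr.le θ))
    ⟨θ, Ioc_subset_Icc_self hθ, hlt⟩
  have h2 : circleAverage f c r < circleAverage (fun _ ↦ m) c r := by
    rw [circleAverage_def, circleAverage_def]
    exact mul_lt_mul_of_pos_left h1 (inv_pos.2 two_pi_pos)
  rw [circleAverage_const] at h2
  exact hge.not_gt h2

variable {X : Type*} [TopologicalSpace X] [ChartedSpace ℂ X] [IsManifold 𝓘(ℂ) ω X] [T2Space X]
  [ConnectedSpace X]

/-- The maximum principle on a compact set `S`. -/
theorem SubharmonicAt.le_zero_of_isCompact {u : X → ℝ} {S O : Set X} (hS : IsCompact S)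
    (hO : IsOpen O) (hOS : O ⊆ S) (hOne : O ≠ univ) (hu : ContinuousOn u S)
    (hsub : ∀ x ∈ O, SubharmonicAt u x) (hb : ∀ x ∈ S, x ∉ O → u x ≤ 0) :
    ∀ x ∈ S, u x ≤ 0 := by
  by_contra! ⟨x₀, hx₀S, hx₀⟩
  obtain ⟨x₁, hx₁S, hx₁⟩ := hS.exists_isMaxOn ⟨x₀, hx₀S⟩ hu
  set m := u x₁
  have hm : 0 < m := hx₀.trans_le (hx₁ hx₀S)
  -- If the maximum m is positive, the set where it is attained lies in O and is closed and open, so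
  -- it is all of X, contradicting O ≠ X.
  set T := S ∩ u ⁻¹' {m}
  have hTO : T ⊆ O := fun x hx ↦ by
    by_contra h
    have h1 := hb x hx.1 h
    rw [show u x = m from hx.2] at h1
    exact h1.not_gt hm
  have hclosed : IsClosed T := hu.preimage_isClosed_of_isClosed hS.isClosed isClosed_singleton
  have hopen : IsOpen T := by
    rw [isOpen_iff_mem_nhds]
    intro x hx
    have hxs := mem_chart_source ℂ x
    set φ := chartAt ℂ x
    have hsx := hsub x (hTO hx)
    have hev := (hsx.2 φ (isHolomorphicChart_chartAt x) hxs).and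
      (eventually_circle_of_eventually ((hO.eventually_mem (hTO hx)).and hsx.1) hxs)
    obtain ⟨R, hR, hRs⟩ := (mem_nhdsGT_iff_exists_Ioo_subset).1 hev
    filter_upwards [φ.open_source.mem_nhds hxs,
      (φ.continuousAt hxs).preimage_mem_nhds (ball_mem_nhds _ hR)] with y hy hyR
    rcases eq_or_ne y x with rfl | hne
    · exact hx
    -- Every y near x lies on a small circle about x, on which the sub-mean value property forces u
    -- = m.
    have hpos : 0 < dist (φ y) (φ x) := dist_pos.2 fun h ↦ hne (φ.injOn hy hxs h)
    obtain ⟨h1, h2, h3⟩ := hRs ⟨hpos, hyR⟩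
    have h4 := eqOn_sphere_of_le_circleAverage (f := u ∘ φ.symm) (m := m) hpos
      ((continuousOn_comp_symm_of_continuousAt fun z hz ↦
        ⟨(h3 z hz).1, (h3 z hz).2.2⟩).mono sphere_subset_closedBall)
      (fun z hz ↦ hx₁ (hOS (h3 z (sphere_subset_closedBall hz)).2.1))
      (by rwa [show u x = m from hx.2] at h1) (φ y) rfl
    have h5 := (h3 (φ y) (mem_closedBall.2 le_rfl)).2.1
    simp only [Function.comp_apply, φ.left_inv hy] at h4 h5
    exact ⟨hOS h5, h4⟩
  have : T = univ := IsClopen.eq_univ ⟨hclosed, hopen⟩ ⟨x₁, hx₁S, rfl⟩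
  exact hOne (univ_subset_iff.1 (this ▸ hTO))

end MaximumPrinciple

/-! ### Poisson modification and removable punctures. -/

section PoissonModification

variable {X : Type*} [TopologicalSpace X]

/-- The part of the domain of the chart `φ` that `φ` maps into `s`. -/
def chartPreimage (φ : OpenPartialHomeomorph X ℂ) (s : Set ℂ) : Set X :=
  φ.source ∩ φ ⁻¹' s

variable {φ : OpenPartialHomeomorph X ℂ} {v : X → ℝ} {x : X} {s : Set ℂ}

lemma isOpen_chartPreimage (hs : IsOpen s) : IsOpen (chartPreimage φ s) :=
  φ.isOpen_inter_preimage hs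

lemma isCompact_chartPreimage (hs : IsCompact s) (hst : s ⊆ φ.target) :
    IsCompact (chartPreimage φ s) := by
  rw [chartPreimage, ← φ.symm_image_eq_source_inter_preimage hst]
  exact hs.image_of_continuousOn (φ.continuousOn_symm.mono hst)

lemma symm_mem_chartPreimage (hst : s ⊆ φ.target) {z : ℂ} (hz : z ∈ s) :
    φ.symm z ∈ chartPreimage φ s :=
  ⟨φ.map_target (hst hz), by simpa [φ.right_inv (hst hz)] using hz⟩

open Classical in
/-- The function `v` with its values in the unit disk of `φ` replaced by the Poisson integral. -/
noncomputable def poissonMod (φ : OpenPartialHomeomorph X ℂ) (v : X → ℝ) (x : X) : ℝ :=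
  if x ∈ φ.source then diskExtend (v ∘ φ.symm) (φ x) else v x

lemma poissonMod_of_mem_source (hx : x ∈ φ.source) :
    poissonMod φ v x = diskExtend (v ∘ φ.symm) (φ x) := if_pos hx

lemma poissonMod_of_mem (hx : x ∈ chartPreimage φ (ball 0 1)) :
    poissonMod φ v x = diskPoisson (v ∘ φ.symm) (φ x) := by
  rw [poissonMod_of_mem_source hx.1, diskExtend_of_mem hx.2]

lemma poissonMod_of_notMem (hx : x ∉ chartPreimage φ (ball 0 1)) : poissonMod φ v x = v x := by
  by_cases h : x ∈ φ.source
  · rw [poissonMod_of_mem_source h, diskExtend_of_notMem fun h' ↦ hx ⟨h, h'⟩]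
    simp [φ.left_inv h]
  · exact if_neg h

lemma continuousOn_sphere_comp_symm (hb : closedBall 0 1 ⊆ φ.target)
    (hv : ∀ x ∈ chartPreimage φ (sphere 0 1), ContinuousAt v x) :
    ContinuousOn (v ∘ φ.symm) (sphere 0 1) :=
  continuousOn_comp_symm_of_continuousAt fun _ hz ↦ ⟨hb (sphere_subset_closedBall hz),
    hv _ (symm_mem_chartPreimage (sphere_subset_closedBall.trans hb) hz)⟩

lemma poissonMod_eventuallyEq [T2Space X] (hb : closedBall 0 1 ⊆ φ.target)
    (hx : x ∉ chartPreimage φ (closedBall 0 1)) : ∀ᶠ y in 𝓝 x, poissonMod φ v y = v y := by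
  have h := (isCompact_chartPreimage (isCompact_closedBall 0 1) hb).isClosed
  filter_upwards [h.isOpen_compl.mem_nhds hx] with y hy
  exact poissonMod_of_notMem fun h ↦ hy ⟨h.1, ball_subset_closedBall h.2⟩

lemma continuousAt_poissonMod [T2Space X] (hb : closedBall 0 1 ⊆ φ.target)
    (hv : ∀ x ∈ chartPreimage φ (sphere 0 1), ContinuousAt v x)
    (hx : x ∉ chartPreimage φ (ball 0 1) → ContinuousAt v x) :
    ContinuousAt (poissonMod φ v) x := by
  by_cases h : x ∈ φ.source
  · have h1 : ContinuousAt (diskExtend (v ∘ φ.symm)) (φ x) := by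
      rw [← continuousWithinAt_univ]
      refine continuousWithinAt_diskExtend (continuousOn_sphere_comp_symm hb hv) fun hw ↦ ?_
      rw [continuousWithinAt_univ]
      refine ContinuousAt.comp ?_ (φ.continuousAt_symm (φ.map_source h))
      rw [φ.left_inv h]
      exact hx fun h' ↦ hw h'.2
    refine (h1.comp (φ.continuousAt h)).congr ?_
    filter_upwards [φ.open_source.mem_nhds h] with y hy
    rw [poissonMod_of_mem_source hy, Function.comp_apply]
  · have hx' : x ∉ chartPreimage φ (closedBall 0 1) := fun h' ↦ h h'.1
    refine (hx fun h' ↦ h h'.1).congr ?_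
    exact (poissonMod_eventuallyEq hb hx').mono fun y hy ↦ hy.symm

lemma chartPreimage_ball_ne_univ (hb : closedBall 0 1 ⊆ φ.target) :
    chartPreimage φ (ball 0 1) ≠ univ := by
  intro h
  have h1 : (1 : ℂ) ∈ closedBall (0 : ℂ) 1 := by simp
  have h2 : φ.symm 1 ∈ chartPreimage φ (ball 0 1) := h ▸ mem_univ _
  have h3 : φ (φ.symm 1) ∈ ball (0 : ℂ) 1 := h2.2
  rw [φ.right_inv (hb h1)] at h3
  simp at h3

variable [ChartedSpace ℂ X]

lemma harmonicNear_poissonMod (hφ : IsHolomorphicChart φ) (hb : closedBall 0 1 ⊆ φ.target)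
    (hv : ∀ x ∈ chartPreimage φ (sphere 0 1), ContinuousAt v x)
    (hx : x ∈ chartPreimage φ (ball 0 1)) : HarmonicNear (poissonMod φ v) x := by
  refine (HarmonicAt.harmonicNear_comp hφ hx.1
    (harmonicAt_diskExtend (continuousOn_sphere_comp_symm hb hv) hx.2)).congr ?_
  filter_upwards [φ.open_source.mem_nhds hx.1] with y hy using poissonMod_of_mem_source hy

variable [IsManifold 𝓘(ℂ) ω X] [T2Space X] [ConnectedSpace X]

/-- The difference between v and its modification is subharmonic in the disk and vanishes on the
circle, so the maximum principle applies. -/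
lemma le_poissonMod (hφ : IsHolomorphicChart φ) (hb : closedBall 0 1 ⊆ φ.target)
    (hv : ∀ x ∈ chartPreimage φ (sphere 0 1), ContinuousAt v x)
    (hsub : ∀ x ∈ chartPreimage φ (ball 0 1), SubharmonicAt v x) (x : X) :
    v x ≤ poissonMod φ v x := by
  by_cases hx : x ∈ chartPreimage φ (ball 0 1)
  swap
  · rw [poissonMod_of_notMem hx]
  have hv' : ∀ x ∈ chartPreimage φ (closedBall 0 1), ContinuousAt v x := by
    intro x hx
    rcases (ball_union_sphere (x := (0 : ℂ)) (ε := 1)).ge hx.2 with h | h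
    · exact (hsub x ⟨hx.1, h⟩).continuousAt
    · exact hv x ⟨hx.1, h⟩
  have := SubharmonicAt.le_zero_of_isCompact (u := v + -poissonMod φ v)
    (isCompact_chartPreimage (isCompact_closedBall 0 1) hb)
    (isOpen_chartPreimage (φ := φ) isOpen_ball)
    (fun y hy ↦ ⟨hy.1, ball_subset_closedBall hy.2⟩) (chartPreimage_ball_ne_univ hb)
    (fun y hy ↦ ((hv' y hy).add
      (continuousAt_poissonMod hb hv fun _ ↦ hv' y hy).neg).continuousWithinAt)
    (fun y hy ↦ (hsub y hy).add (harmonicNear_poissonMod hφ hb hv hy).neg.subharmonicAt)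
    (fun y _ hy ↦ by simp [poissonMod_of_notMem hy]) x ⟨hx.1, ball_subset_closedBall hx.2⟩
  simp only [Pi.add_apply, Pi.neg_apply] at this
  linarith

/-- Inside the disk the modification is harmonic; elsewhere it lies above v and touches it. -/
lemma SubharmonicAt.poissonMod (hφ : IsHolomorphicChart φ) (hb : closedBall 0 1 ⊆ φ.target)
    (hv : ∀ x ∈ chartPreimage φ (closedBall 0 1), SubharmonicAt v x) (hx : SubharmonicAt v x) :
    SubharmonicAt (poissonMod φ v) x := by
  have hvs : ∀ x ∈ chartPreimage φ (sphere 0 1), ContinuousAt v x := fun x hx ↦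
    (hv x ⟨hx.1, sphere_subset_closedBall hx.2⟩).continuousAt
  by_cases h : x ∈ chartPreimage φ (ball 0 1)
  · exact (harmonicNear_poissonMod hφ hb hvs h).subharmonicAt
  refine hx.of_le ?_ (poissonMod_of_notMem h) (Eventually.of_forall fun y ↦
    le_poissonMod hφ hb hvs (fun y hy ↦ hv y ⟨hy.1, ball_subset_closedBall hy.2⟩) y)
  exact hx.1.mono fun y hy ↦ continuousAt_poissonMod hb hvs fun _ ↦ hy

/-- The maximum principle on a punctured disk: the puncture is negligible for functions that are
bounded above. -/
theorem SubharmonicAt.le_zero_of_punctured {u : X → ℝ} (hφ : IsHolomorphicChart φ)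
    (hb : closedBall 0 1 ⊆ φ.target)
    (hc : ∀ x ∈ chartPreimage φ (sphere 0 1), ContinuousAt u x)
    (hsub : ∀ x ∈ chartPreimage φ (ball 0 1 \ {0}), SubharmonicAt u x)
    (hbd : ∃ M, ∀ᶠ x in 𝓝[≠] (φ.symm 0), u x ≤ M)
    (hs : ∀ x ∈ chartPreimage φ (sphere 0 1), u x ≤ 0) :
    ∀ x ∈ chartPreimage φ (closedBall 0 1 \ {0}), u x ≤ 0 := by
  intro x hx
  obtain ⟨M, hM⟩ := hbd
  have h0 : (0 : ℂ) ∈ φ.target := hb (by simp)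
  have hx0 : 0 < ‖φ x‖ := norm_pos_iff.2 hx.2.2
  obtain ⟨R, hR, hRM⟩ : ∃ R > 0, ∀ y ∈ φ.source, ‖φ y‖ < R → φ y ≠ 0 → u y ≤ M := by
    have h1 : ∀ᶠ z in 𝓝 (0 : ℂ), φ.symm z ≠ φ.symm 0 → u (φ.symm z) ≤ M :=
      (φ.continuousAt_symm h0).eventually (eventually_nhdsWithin_iff.1 hM)
    obtain ⟨R, hR, h2⟩ := Metric.eventually_nhds_iff_ball.1 h1
    refine ⟨R, hR, fun y hy hyR hy0 ↦ ?_⟩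
    have h3 := h2 (φ y) (by simpa using hyR)
    rw [φ.left_inv hy] at h3
    exact h3 fun h ↦ hy0 (by rw [h, φ.right_inv h0])
  -- The harmonic term ε log‖φ‖ vanishes on the unit circle and tends to -∞ at the puncture, so it
  -- absorbs the bound M on a circle of small radius δ. Letting ε tend to 0 afterwards removes it.
  have key : ∀ ε > 0, u x + ε * Real.log ‖φ x‖ ≤ 0 := by
    intro ε hε
    have hlim : Tendsto (fun δ ↦ M + ε * Real.log δ) (𝓝[>] 0) atBot :=
      tendsto_atBot_add_const_left _ _ (tendsto_log_nhdsGT_zero.const_mul_atBot hε)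
    obtain ⟨δ, hδM, hδ0, hδ⟩ := ((hlim.eventually_le_atBot 0).and
      (Ioo_mem_nhdsGT (show (0 : ℝ) < min R (min 1 ‖φ x‖) by positivity))).exists
    rw [lt_min_iff, lt_min_iff] at hδ
    have hL : ∀ y ∈ φ.source, φ y ≠ 0 → HarmonicNear (fun y ↦ Real.log ‖φ y‖) y := by
      intro y hy hy0
      simpa using harmonicNear_log_norm hφ hy hy0
    have hne : ∀ y : X, y ∈ chartPreimage φ (closedBall 0 1 \ ball 0 δ) → φ y ≠ 0 := by
      intro y hy h
      exact hy.2.2 (by simpa [h] using hδ0)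
    have := SubharmonicAt.le_zero_of_isCompact (u := u + ε • fun y ↦ Real.log ‖φ y‖)
      (S := chartPreimage φ (closedBall 0 1 \ ball 0 δ))
      (O := chartPreimage φ (ball 0 1 \ closedBall 0 δ))
      (isCompact_chartPreimage ((isCompact_closedBall 0 1).diff isOpen_ball)
        (sdiff_subset.trans hb))
      (isOpen_chartPreimage (isOpen_ball.sdiff isClosed_closedBall))
      (fun y hy ↦ ⟨hy.1, ball_subset_closedBall hy.2.1, fun h ↦ hy.2.2 (ball_subset_closedBall h)⟩)
      (fun h ↦ ?_) (fun y hy ↦ ?_) (fun y hy ↦ ?_) (fun y hy hyO ↦ ?_) x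
      ⟨hx.1, hx.2.1, by simpa using hδ.2.2.le⟩
    · simpa using this
    · have h1 : φ.symm 0 ∈ chartPreimage φ (ball 0 1 \ closedBall 0 δ) := h ▸ mem_univ _
      have h2 := h1.2.2
      rw [φ.right_inv h0] at h2
      exact h2 (by simpa using hδ0.le)
    · have hcu : ContinuousAt u y := by
        rcases (ball_union_sphere (x := (0 : ℂ)) (ε := 1)).ge hy.2.1 with h | h
        · exact (hsub y ⟨hy.1, h, hne y hy⟩).continuousAt
        · exact hc y ⟨hy.1, h⟩
      exact (hcu.add ((hL y hy.1 (hne y hy)).continuousAt.const_smul ε)).continuousWithinAt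
    · have hy0 : φ y ≠ 0 := fun h ↦ hy.2.2 (by simpa [h] using hδ0.le)
      exact (hsub y ⟨hy.1, hy.2.1, hy0⟩).add
        ((hL y hy.1 hy0).subharmonicAt.const_smul hε.le)
    · simp only [Pi.add_apply, Pi.smul_apply, smul_eq_mul]
      by_cases h1 : ‖φ y‖ = 1
      · rw [h1, Real.log_one, mul_zero, add_zero]
        exact hs y ⟨hy.1, by simpa using h1⟩
      · have h2 : ‖φ y‖ ≤ 1 := by simpa using hy.2.1
        have h3 : δ ≤ ‖φ y‖ := by simpa using hy.2.2
        have h4 : ‖φ y‖ = δ := by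
          refine le_antisymm ?_ h3
          by_contra! h5
          exact hyO ⟨hy.1, by simpa using h2.lt_of_ne h1, by simpa using h5⟩
        have h5 := hRM y hy.1 (h4 ▸ hδ.1) (hne y hy)
        rw [h4]
        linarith
  have hlim : Tendsto (fun ε ↦ u x + ε * Real.log ‖φ x‖) (𝓝[>] 0) (𝓝 (u x + 0 * Real.log ‖φ x‖)) :=
    (Continuous.tendsto (by fun_prop) 0).mono_left nhdsWithin_le_nhds
  have := le_of_tendsto hlim (by filter_upwards [self_mem_nhdsWithin] with ε hε using key ε hε)
  simpa using this

end PoissonModification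

/-! ### Perron families and their envelopes. -/

section Perron

variable {X : Type*}

/-- The upper envelope of a family of functions. -/
noncomputable def upperEnvelope (F : Set (X → ℝ)) (x : X) : ℝ :=
  sSup ((fun v : X → ℝ ↦ v x) '' F)

lemma le_upperEnvelope {F : Set (X → ℝ)} {x : X} (hb : BddAbove ((fun v : X → ℝ ↦ v x) '' F))
    {v : X → ℝ} (hv : v ∈ F) : v x ≤ upperEnvelope F x :=
  le_csSup hb ⟨v, hv, rfl⟩

lemma upperEnvelope_le {F : Set (X → ℝ)} (hne : F.Nonempty) {x : X} {a : ℝ}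
    (h : ∀ v ∈ F, v x ≤ a) : upperEnvelope F x ≤ a :=
  csSup_le (hne.image _) (by rintro _ ⟨v, hv, rfl⟩; exact h v hv)

lemma exists_lt_of_lt_upperEnvelope {F : Set (X → ℝ)} (hne : F.Nonempty) {x : X} {a : ℝ}
    (h : a < upperEnvelope F x) : ∃ v ∈ F, a < v x := by
  obtain ⟨_, ⟨v, hv, rfl⟩, h⟩ := exists_lt_of_lt_csSup (hne.image _) h
  exact ⟨v, hv, h⟩

variable [TopologicalSpace X]

lemma poissonMod_symm {φ : OpenPartialHomeomorph X ℂ} {v : X → ℝ}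
    (hb : closedBall 0 1 ⊆ φ.target) {w : ℂ} (hw : w ∈ ball (0 : ℂ) 1) :
    poissonMod φ v (φ.symm w) = diskPoisson (v ∘ φ.symm) w := by
  have h := ball_subset_closedBall.trans hb
  rw [poissonMod_of_mem (symm_mem_chartPreimage h hw), φ.right_inv (h hw)]

variable [ChartedSpace ℂ X]

/-- A family of functions to which Perron's method applies on `W`. -/
structure IsPerronFamily (F : Set (X → ℝ)) (W : Set X) : Prop where
  nonempty : F.Nonempty
  continuousAt : ∀ v ∈ F, ∀ x ∈ W, ContinuousAt v x
  nonneg : ∀ v ∈ F, ∀ x ∈ W, 0 ≤ v x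
  bddAbove : ∀ x ∈ W, BddAbove ((fun v : X → ℝ ↦ v x) '' F)
  sup_mem : ∀ u ∈ F, ∀ v ∈ F, u ⊔ v ∈ F
  poissonMod_mem : ∀ φ : OpenPartialHomeomorph X ℂ, IsHolomorphicChart φ → φ.source ⊆ W →
    closedBall 0 1 ⊆ φ.target → ∀ v ∈ F, poissonMod φ v ∈ F
  le_poissonMod : ∀ φ : OpenPartialHomeomorph X ℂ, IsHolomorphicChart φ → φ.source ⊆ W →
    closedBall 0 1 ⊆ φ.target → ∀ v ∈ F, v ≤ poissonMod φ v

variable {F : Set (X → ℝ)} {W : Set X} {φ : OpenPartialHomeomorph X ℂ}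

/-- A member need not satisfy Harnack's inequality, but its Poisson integral does. That integral
lies above the member and, being given by another member, below the envelope; the constants do not
depend on the member. -/
lemma IsPerronFamily.harnack (hF : IsPerronFamily F W) (hφ : IsHolomorphicChart φ)
    (hφW : φ.source ⊆ W) (hb : closedBall 0 1 ⊆ φ.target) {w : ℂ} (hw : w ∈ ball (0 : ℂ) 1) :
    upperEnvelope F (φ.symm w) ≤ (1 + ‖w‖) / (1 - ‖w‖) * upperEnvelope F (φ.symm 0) ∧
    upperEnvelope F (φ.symm 0) ≤ (1 + ‖w‖) / (1 - ‖w‖) * upperEnvelope F (φ.symm w) := by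
  have h0 : (0 : ℂ) ∈ ball (0 : ℂ) 1 := by simp
  have hw1 : ‖w‖ < 1 := by simpa using hw
  have hk : 0 ≤ (1 + ‖w‖) / (1 - ‖w‖) := div_nonneg (by positivity) (by linarith)
  have hmem : ∀ z ∈ closedBall (0 : ℂ) 1, φ.symm z ∈ W := fun z hz ↦ hφW (φ.map_target (hb hz))
  have hcont : ∀ v ∈ F, ContinuousOn (v ∘ φ.symm) (sphere 0 1) := fun v hv ↦
    continuousOn_sphere_comp_symm hb fun x hx ↦ hF.continuousAt v hv x (hφW hx.1)
  have hnn : ∀ v ∈ F, ∀ z ∈ sphere (0 : ℂ) 1, 0 ≤ (v ∘ φ.symm) z := fun v hv z hz ↦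
    hF.nonneg v hv _ (hmem z (sphere_subset_closedBall hz))
  have hle : ∀ v ∈ F, ∀ z ∈ ball (0 : ℂ) 1, v (φ.symm z) ≤ diskPoisson (v ∘ φ.symm) z ∧
      diskPoisson (v ∘ φ.symm) z ≤ upperEnvelope F (φ.symm z) := fun v hv z hz ↦ by
    rw [← poissonMod_symm hb hz]
    exact ⟨hF.le_poissonMod φ hφ hφW hb v hv _, le_upperEnvelope
      (hF.bddAbove _ (hmem z (ball_subset_closedBall hz))) (hF.poissonMod_mem φ hφ hφW hb v hv)⟩
  constructor <;> refine upperEnvelope_le hF.nonempty fun v hv ↦ ?_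
  · exact (hle v hv w hw).1.trans ((diskPoisson_le_harnack (hcont v hv) hw (hnn v hv)).trans
      (mul_le_mul_of_nonneg_left (hle v hv 0 h0).2 hk))
  · refine (hle v hv 0 h0).1.trans (le_trans ?_ (mul_le_mul_of_nonneg_left (hle v hv w hw).2 hk))
    have h1 := harnack_le_diskPoisson (hcont v hv) hw (hnn v hv)
    rw [div_mul_eq_mul_div, div_le_iff₀ (by positivity)] at h1
    rw [div_mul_eq_mul_div, le_div_iff₀ (by linarith)]
    linarith

variable [IsManifold 𝓘(ℂ) ω X]

/-- The Harnack constants tend to 1 at the centre of the disk, so the envelope is squeezed. -/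
lemma IsPerronFamily.continuousAt_upperEnvelope (hF : IsPerronFamily F W) (hW : IsOpen W)
    {x : X} (hx : x ∈ W) : ContinuousAt (upperEnvelope F) x := by
  obtain ⟨φ, hφ, hxs, hφW, hb, hx0⟩ := exists_disk_chart_at x (hW.mem_nhds hx)
  have hsx : φ.symm 0 = x := by rw [← hx0, φ.left_inv hxs]
  have hn : Tendsto (fun y ↦ ‖φ y‖) (𝓝 x) (𝓝 0) := by
    have := (φ.continuousAt hxs).norm
    rwa [ContinuousAt, hx0, norm_zero] at this
  have hk : Tendsto (fun y ↦ (1 + ‖φ y‖) / (1 - ‖φ y‖)) (𝓝 x) (𝓝 1) := by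
    have : Tendsto (fun y ↦ (1 + ‖φ y‖) / (1 - ‖φ y‖)) (𝓝 x) (𝓝 ((1 + 0) / (1 - 0))) :=
      (hn.const_add 1).div (hn.const_sub 1) (by simp)
    simpa using this
  have hlow : Tendsto (fun y ↦ upperEnvelope F x / ((1 + ‖φ y‖) / (1 - ‖φ y‖))) (𝓝 x)
      (𝓝 (upperEnvelope F x)) := by
    have := (tendsto_const_nhds (x := upperEnvelope F x)).div hk one_ne_zero
    rwa [div_one] at this
  have hupp : Tendsto (fun y ↦ (1 + ‖φ y‖) / (1 - ‖φ y‖) * upperEnvelope F x) (𝓝 x)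
      (𝓝 (upperEnvelope F x)) := by
    simpa using hk.mul_const (upperEnvelope F x)
  have hev : ∀ᶠ y in 𝓝 x, y ∈ φ.source ∧ ‖φ y‖ < 1 :=
    (φ.open_source.eventually_mem hxs).and (hn.eventually (gt_mem_nhds one_pos))
  refine tendsto_of_tendsto_of_tendsto_of_le_of_le' hlow hupp ?_ ?_ <;>
    filter_upwards [hev] with y hy <;>
    have hpos : 0 < (1 + ‖φ y‖) / (1 - ‖φ y‖) := div_pos (by positivity) (by linarith [hy.2]) <;>
    have := hF.harnack hφ hφW hb (w := φ y) (by simpa using hy.2) <;>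
    rw [φ.left_inv hy.1, hsx] at this
  · rw [div_le_iff₀' hpos]
    exact this.2
  · exact this.1

/-- **Perron's theorem**. -/
theorem IsPerronFamily.isHarmonicOn_upperEnvelope (hF : IsPerronFamily F W) (hW : IsOpen W) :
    IsHarmonicOn (upperEnvelope F) W := by
  have hG := fun x (hx : x ∈ W) ↦ hF.continuousAt_upperEnvelope hW hx
  refine ⟨fun x hx ↦ (hG x hx).continuousWithinAt, fun φ hφ hφW hb ↦ ?_⟩
  set K := chartPreimage φ (closedBall 0 1)
  have hK : IsCompact K := isCompact_chartPreimage (isCompact_closedBall 0 1) hb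
  have hKW : K ⊆ W := fun x hx ↦ hφW hx.1
  have h0 : (0 : ℂ) ∈ closedBall (0 : ℂ) 1 := by simp
  have hint : ∀ {u : X → ℝ}, (∀ x ∈ W, ContinuousAt u x) →
      CircleIntegrable (u ∘ φ.symm) 0 1 := fun hu ↦
    (continuousOn_sphere_comp_symm hb fun x hx ↦ hu x (hφW hx.1)).circleIntegrable zero_le_one
  -- Dini-type argument: the envelope and the members are continuous, so pointwise approximation
  -- persists nearby, and maxima of finitely many members cover the compact disk.
  have happrox : ∀ ε > 0, ∃ v ∈ F, ∀ x ∈ K, upperEnvelope F x < v x + ε := by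
    intro ε hε
    refine hK.induction_on (p := fun s ↦ ∃ v ∈ F, ∀ x ∈ s, upperEnvelope F x < v x + ε) ?_ ?_ ?_ ?_
    · obtain ⟨v, hv⟩ := hF.nonempty
      exact ⟨v, hv, by simp⟩
    · rintro s t hst ⟨v, hv, h⟩
      exact ⟨v, hv, fun x hx ↦ h x (hst hx)⟩
    · rintro s t ⟨u, hu, h⟩ ⟨v, hv, h'⟩
      refine ⟨u ⊔ v, hF.sup_mem u hu v hv, ?_⟩
      rintro x (hx | hx)
      · exact (h x hx).trans_le (by gcongr; exact le_sup_left (a := u x))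
      · exact (h' x hx).trans_le (by gcongr; exact le_sup_right (b := v x))
    · intro x hx
      obtain ⟨v, hv, h⟩ := exists_lt_of_lt_upperEnvelope hF.nonempty
        (sub_lt_self (upperEnvelope F x) hε)
      refine ⟨_, mem_nhdsWithin_of_mem_nhds ?_, v, hv, fun y hy ↦ hy⟩
      exact ((hG x (hKW hx)).tendsto).eventually_lt
        ((hF.continuousAt v hv x (hKW hx)).add continuousAt_const) (sub_lt_iff_lt_add.1 h)
  have key : ∀ ε > 0, |circleAverage (upperEnvelope F ∘ φ.symm) 0 1 -
      upperEnvelope F (φ.symm 0)| ≤ ε := by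
    intro ε hε
    obtain ⟨v, hv, hvε⟩ := happrox ε hε
    have hc : ∀ x ∈ W, ContinuousAt v x := hF.continuousAt v hv
    -- The circle mean of v is the central value of its modification, so it lies between v and the
    -- envelope there, which differ by less than ε.
    have hmid : v (φ.symm 0) ≤ circleAverage (v ∘ φ.symm) 0 1 ∧
        circleAverage (v ∘ φ.symm) 0 1 ≤ upperEnvelope F (φ.symm 0) := by
      rw [← diskPoisson_zero, ← poissonMod_symm hb (by simp)]
      exact ⟨hF.le_poissonMod φ hφ hφW hb v hv _, le_upperEnvelope
        (hF.bddAbove _ (hφW (φ.map_target (hb h0)))) (hF.poissonMod_mem φ hφ hφW hb v hv)⟩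
    have h1 : circleAverage (v ∘ φ.symm) 0 1 ≤ circleAverage (upperEnvelope F ∘ φ.symm) 0 1 := by
      refine circleAverage_mono (hint hc) (hint hG) fun z hz ↦ ?_
      rw [abs_one] at hz
      exact le_upperEnvelope (hF.bddAbove _ (hφW (φ.map_target
        (hb (sphere_subset_closedBall hz))))) hv
    have h2 : circleAverage (upperEnvelope F ∘ φ.symm) 0 1 ≤
        circleAverage (v ∘ φ.symm) 0 1 + ε := by
      have : circleAverage (v ∘ φ.symm + fun _ ↦ ε) 0 1 = circleAverage (v ∘ φ.symm) 0 1 + ε := by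
        rw [circleAverage_add (hint hc) (by simp), circleAverage_const]
      rw [← this]
      refine circleAverage_mono (hint hG) ((hint hc).add (by simp)) fun z hz ↦ ?_
      rw [abs_one] at hz
      exact (hvε _ (symm_mem_chartPreimage hb (sphere_subset_closedBall hz))).le
    have h3 := hvε _ (symm_mem_chartPreimage hb h0)
    rw [abs_le]
    constructor <;> linarith
  have := le_of_forall_pos_le_add (fun ε hε ↦ (key ε hε).trans_eq (zero_add ε).symm)
  exact sub_eq_zero.1 (abs_nonpos_iff.1 this)

end Perron

/-! ### Uniform contraction away from a disk. -/

section Contraction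

/-- Polar coordinates exhibit the half-open annulus as a continuous image of a convex strip. It
serves as a connected collar around the half disk. -/
lemma isPreconnected_annulus {a b : ℝ} (ha : 0 ≤ a) :
    IsPreconnected (closedBall (0 : ℂ) b \ closedBall 0 a) := by
  have h : closedBall (0 : ℂ) b \ closedBall 0 a =
      (fun p : ℝ × ℝ ↦ circleMap 0 p.1 p.2) '' (Ioc a b ×ˢ univ) := by
    ext z
    simp only [Set.mem_sdiff, mem_closedBall, dist_zero_right, not_le, mem_image, mem_prod, mem_Ioc,
      mem_univ, and_true, Prod.exists]
    constructor
    · rintro ⟨h1, h2⟩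
      exact ⟨‖z‖, z.arg, ⟨h2, h1⟩, by simp [circleMap, norm_mul_exp_arg_mul_I]⟩
    · rintro ⟨s, t, ⟨h1, h2⟩, rfl⟩
      rw [norm_circleMap_zero, abs_of_pos (ha.trans_lt h1)]
      exact ⟨h2, h1⟩
  rw [h]
  refine ((convex_Ioc a b).isPreconnected.prod isPreconnected_univ).image _ ?_
  simp only [circleMap]
  fun_prop

lemma diskPoisson_add {f g : ℂ → ℝ} {w : ℂ} (hf : ContinuousOn f (sphere 0 1))
    (hg : ContinuousOn g (sphere 0 1)) (hw : w ∈ ball (0 : ℂ) 1) :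
    diskPoisson (f + g) w = diskPoisson f w + diskPoisson g w := by
  rw [diskPoisson, smul_add, circleAverage_add (circleIntegrable_poissonKernel_smul hf hw)
    (circleIntegrable_poissonKernel_smul hg hw)]
  rfl

variable {X : Type*} [TopologicalSpace X] [ChartedSpace ℂ X] [IsManifold 𝓘(ℂ) ω X] [T2Space X]
  [ConnectedSpace X] {φ : OpenPartialHomeomorph X ℂ}

/-- A uniform bound `θ < 1` near one boundary point of a disk propagates to the centre, for
subharmonic functions that are at most `1`. -/
lemma exists_uniform_lt_one_center {V : Set (X → ℝ)} (hφ : IsHolomorphicChart φ)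
    (hb : closedBall 0 1 ⊆ φ.target)
    (hV : ∀ v ∈ V, ∀ x ∈ φ.source, SubharmonicAt v x ∧ v x ≤ 1) {y : X}
    (hy : y ∈ chartPreimage φ (sphere 0 1)) {N : Set X} (hN : N ∈ 𝓝 y) {θ : ℝ} (hθ : θ < 1)
    (hNθ : ∀ v ∈ V, ∀ x ∈ N, v x ≤ θ) :
    ∃ N' ∈ 𝓝 (φ.symm 0), ∃ θ' < 1, ∀ v ∈ V, ∀ x ∈ N', v x ≤ θ' := by
  obtain ⟨δ, hδ, hδN⟩ : ∃ δ > 0, ∀ z ∈ ball (φ y) δ, φ.symm z ∈ N := by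
    have := φ.continuousAt_symm (φ.map_source hy.1)
    rw [ContinuousAt, φ.left_inv hy.1] at this
    exact Metric.mem_nhds_iff.1 (this hN)
  -- A tent of height 1 - θ at y, supported in the δ-disk: on the circle every v is at most 1 - g,
  -- so inside it is at most 1 minus the Poisson integral of g, which is positive at the centre.
  set g : ℂ → ℝ := fun z ↦ (1 - θ) * max 0 (1 - ‖z - φ y‖ / δ) with hg
  have hgc : Continuous g := by fun_prop
  have hg0 : ∀ z, 0 ≤ g z := fun z ↦ mul_nonneg (by linarith) (le_max_left _ _)
  have hgy : 0 < g (φ y) := by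
    simp only [hg, sub_self, norm_zero, zero_div, sub_zero]
    rw [max_eq_right zero_le_one]
    linarith
  have hpos : 0 < diskPoisson g 0 := by
    rw [diskPoisson_zero]
    by_contra! h
    have h1 := eqOn_sphere_of_le_circleAverage (f := (-1 : ℝ) • g) (c := 0) (m := 0) one_pos
      (hgc.const_smul _).continuousOn (fun z _ ↦ by simpa using hg0 z)
      (by rw [circleAverage_smul]; simpa using h) (φ y) hy.2
    simp only [Pi.smul_apply, smul_eq_mul] at h1
    linarith
  have hvle : ∀ v ∈ V, ∀ z ∈ sphere (0 : ℂ) 1, v (φ.symm z) ≤ 1 - g z := by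
    intro v hv z hz
    by_cases hd : z ∈ ball (φ y) δ
    · have h1 := hNθ v hv _ (hδN z hd)
      have h2 : max 0 (1 - ‖z - φ y‖ / δ) ≤ 1 :=
        max_le zero_le_one (by linarith [div_nonneg (norm_nonneg (z - φ y)) hδ.le])
      have h3 : g z ≤ 1 - θ := mul_le_of_le_one_right (by linarith) h2
      linarith
    · have h1 := (hV v hv _ (φ.map_target (hb (sphere_subset_closedBall hz)))).2
      have h2 : g z = 0 := by
        rw [mem_ball, not_lt, dist_eq_norm] at hd
        have : 1 ≤ ‖z - φ y‖ / δ := (one_le_div hδ).2 hd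
        simp only [hg]
        rw [max_eq_left (by linarith), mul_zero]
      linarith
  have hcont : ContinuousAt (diskPoisson g) 0 :=
    (harmonicAt_diskPoisson hgc.continuousOn (by simp)).1.continuousAt
  have h0 : (0 : ℂ) ∈ φ.target := hb (by simp)
  have hs0 := φ.map_target h0
  have hev : ∀ᶠ x in 𝓝 (φ.symm 0), x ∈ φ.source ∧ φ x ∈ ball (0 : ℂ) 1 ∧
      diskPoisson g 0 / 2 < diskPoisson g (φ x) := by
    have hφc := φ.continuousAt hs0
    rw [ContinuousAt, φ.right_inv h0] at hφc
    exact (φ.open_source.eventually_mem hs0).and ((hφc.eventually (ball_mem_nhds _ one_pos)).and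
      (hφc.eventually (hcont.eventually (lt_mem_nhds (half_lt_self hpos)))))
  refine ⟨_, hev, 1 - diskPoisson g 0 / 2, by linarith, fun v hv x ⟨hxs, hxb, hx⟩ ↦ ?_⟩
  have hvc : ContinuousOn (v ∘ φ.symm) (sphere 0 1) :=
    continuousOn_sphere_comp_symm hb fun x hx ↦ (hV v hv x hx.1).1.continuousAt
  have h1 := le_poissonMod hφ hb (fun x hx ↦ (hV v hv x hx.1).1.continuousAt)
    (fun x hx ↦ (hV v hv x hx.1).1) x
  rw [poissonMod_of_mem ⟨hxs, hxb⟩] at h1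
  have h2 := diskPoisson_mono (hvc.add hgc.continuousOn) continuousOn_const hxb
    (g₂ := fun _ ↦ 1) (fun z hz ↦ by
      have := hvle v hv z hz
      simp only [Pi.add_apply, Function.comp_apply]
      linarith)
  rw [diskPoisson_add hvc hgc.continuousOn hxb, diskPoisson_const 1 hxb] at h2
  linarith

/-- Subharmonic functions outside a disk that are at most `1`, and nonpositive on a fixed open
set, are bounded on a larger circle by a constant less than `1`. -/
theorem exists_contraction (hb : closedBall 0 1 ⊆ φ.target) {D : Set X} (hD : IsOpen D)
    (hDne : D.Nonempty) (hDφ : ∀ x ∈ D, x ∉ φ.source) :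
    ∃ θ < 1, ∀ v : X → ℝ,
      (∀ x ∉ chartPreimage φ (closedBall 0 (1 / 2)), SubharmonicAt v x ∧ v x ≤ 1) →
      (∀ x ∈ D, v x ≤ 0) → ∀ x ∈ chartPreimage φ (sphere 0 1), v x ≤ θ := by
  set B := chartPreimage φ (closedBall 0 (1 / 2))
  have hhalf : closedBall (0 : ℂ) (1 / 2) ⊆ ball 0 1 := closedBall_subset_ball (by norm_num)
  have hB : IsClosed B := (isCompact_chartPreimage (isCompact_closedBall _ _)
    ((hhalf.trans ball_subset_closedBall).trans hb)).isClosed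
  set V : Set (X → ℝ) := {v | (∀ x ∉ B, SubharmonicAt v x ∧ v x ≤ 1) ∧ ∀ x ∈ D, v x ≤ 0}
  -- A consists of the points off B with a neighbourhood on which all of V is bounded by one
  -- constant below 1.
  set A : Set X := {x | x ∉ B ∧ ∃ N ∈ 𝓝 x, ∃ θ < 1, ∀ v ∈ V, ∀ y ∈ N, v y ≤ θ}
  have hAo : IsOpen A := by
    rw [isOpen_iff_mem_nhds]
    rintro x ⟨hxB, N, hN, θ, hθ, h⟩
    filter_upwards [hB.isOpen_compl.mem_nhds hxB, eventually_mem_nhds_iff.2 hN] with y hy hyN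
    exact ⟨hy, N, hyN, θ, hθ, h⟩
  have hAD : D ⊆ A := fun x hx ↦
    ⟨fun h ↦ hDφ x hx h.1, D, hD.mem_nhds hx, 0, one_pos, fun v hv y hy ↦ hv.2 y hy⟩
  -- A limit point z off B is the centre of a disk off B whose bounding circle passes through a
  -- point y of A; the bound at y propagates to z.
  have hAc : closure A \ B ⊆ A := by
    rintro z ⟨hz, hzB⟩
    obtain ⟨ψ, hψ, hzψ, hψB, hψb, hψz⟩ := exists_disk_chart_at z (hB.isOpen_compl.mem_nhds hzB)
    obtain ⟨y, ⟨hys, hyb⟩, hyA⟩ := mem_closure_iff.1 hz (chartPreimage ψ (ball 0 1))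
      (isOpen_chartPreimage isOpen_ball) ⟨hzψ, by simp [hψz]⟩
    rcases eq_or_ne y z with rfl | hne
    · exact hyA
    have hy0 : 0 < ‖ψ y‖ := norm_pos_iff.2 fun h ↦ hne (ψ.injOn hys hzψ (h.trans hψz.symm))
    have hy1 : ‖ψ y‖ < 1 := by simpa using hyb
    obtain ⟨χ, hχ, hχs, hχb, hχ1, hχ2⟩ := exists_scaled_chart hψ (c := 0) hy0 isOpen_univ
      ((closedBall_subset_closedBall hy1.le).trans hψb) (fun z _ ↦ mem_univ _)
    rw [inter_univ] at hχs
    obtain ⟨-, N, hN, θ, hθ, hNθ⟩ := hyA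
    have := exists_uniform_lt_one_center (V := V) hχ hχb
      (fun v hv x hx ↦ hv.1 x (hψB (hχs ▸ hx))) (y := y)
      ⟨hχs ▸ hys, by simp [hχ1, hy0.ne']⟩ hN hθ hNθ
    rw [hχ2, mul_zero, add_zero, ← hψz, ψ.left_inv hzψ] at this
    exact ⟨hzB, this⟩
  set T := chartPreimage φ (closedBall 0 1 \ closedBall 0 (1 / 2)) with hT
  have hTpre : IsPreconnected T := by
    rw [hT, chartPreimage, ← φ.symm_image_eq_source_inter_preimage (sdiff_subset.trans hb)]
    exact (isPreconnected_annulus (by norm_num)).image _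
      (φ.continuousOn_symm.mono (sdiff_subset.trans hb))
  have hTB : ∀ x ∈ T, x ∉ B := fun x hx h ↦ hx.2.2 h.2
  -- If the collar missed A, so would the whole open unit disk, because A avoids B. Then A would be
  -- closed as well as open, hence all of X, which is absurd.
  have hTA : (T ∩ A).Nonempty := by
    by_contra hemp
    rw [not_nonempty_iff_eq_empty] at hemp
    have hcl : IsClosed A := by
      refine isClosed_of_closure_subset fun z hz ↦ ?_
      by_cases hzB : z ∈ B
      · obtain ⟨y, hy, hyA⟩ := mem_closure_iff.1 hz (chartPreimage φ (ball 0 1))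
          (isOpen_chartPreimage isOpen_ball) ⟨hzB.1, hhalf hzB.2⟩
        have : y ∈ T ∩ A :=
          ⟨⟨hy.1, ball_subset_closedBall hy.2, fun h ↦ hyA.1 ⟨hy.1, h⟩⟩, hyA⟩
        rw [hemp] at this
        exact this.elim
      · exact hAc ⟨hz, hzB⟩
    have hu : A = univ := IsClopen.eq_univ ⟨hcl, hAo⟩ (hDne.mono hAD)
    have h0 : φ.symm 0 ∈ A := hu ▸ mem_univ _
    exact h0.1 (symm_mem_chartPreimage ((hhalf.trans ball_subset_closedBall).trans hb) (by simp))
  have hTsub : T ⊆ A := hTpre.subset_of_closure_inter_subset hAo hTA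
    fun z hz ↦ hAc ⟨hz.1, hTB z hz.2⟩
  have hS : IsCompact (chartPreimage φ (sphere 0 1)) :=
    isCompact_chartPreimage (isCompact_sphere 0 1) (sphere_subset_closedBall.trans hb)
  have hSA : chartPreimage φ (sphere 0 1) ⊆ A := fun x hx ↦ hTsub
    ⟨hx.1, sphere_subset_closedBall hx.2, fun h ↦ (hhalf h).ne (mem_sphere.1 hx.2)⟩
  obtain ⟨θ, hθ, h⟩ := hS.induction_on (p := fun s ↦ ∃ θ < 1, ∀ v ∈ V, ∀ y ∈ s, v y ≤ θ)
    ⟨0, one_pos, by simp⟩ (fun s t hst ⟨θ, hθ, h⟩ ↦ ⟨θ, hθ, fun v hv y hy ↦ h v hv y (hst hy)⟩)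
    (by
      rintro s t ⟨θ, hθ, h⟩ ⟨θ', hθ', h'⟩
      refine ⟨max θ θ', max_lt hθ hθ', fun v hv y hy ↦ ?_⟩
      rcases hy with hy | hy
      · exact (h v hv y hy).trans (le_max_left _ _)
      · exact (h' v hv y hy).trans (le_max_right _ _))
    (fun x hx ↦ by
      obtain ⟨-, N, hN, h⟩ := hSA hx
      exact ⟨N, mem_nhdsWithin_of_mem_nhds hN, h⟩)
  exact ⟨θ, hθ, fun v hv hvD x hx ↦ h v ⟨hv, hvD⟩ x hx⟩

end Contraction

/-! ### Competitors, their uniform bound and the Green function. -/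

section GreenFamily

variable {X : Type*} [TopologicalSpace X] [ChartedSpace ℂ X]

/-- The competitors for the Green function of the open set `Y` with pole at the centre of the
disk chart `φ`. -/
structure IsGreenMinorant (φ : OpenPartialHomeomorph X ℂ) (Y : Set X) (v : X → ℝ) : Prop where
  nonneg : ∀ x, 0 ≤ v x
  eq_zero : ∀ x ∉ Y, v x = 0
  compact_support : ∃ C, IsCompact C ∧ ∀ x ∉ C, v x = 0
  subharmonicAt : ∀ x, x ≠ φ.symm 0 → SubharmonicAt v x
  log_bound : ∃ M, ∀ᶠ x in 𝓝[≠] (φ.symm 0), v x + Real.log ‖φ x‖ ≤ M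

variable {φ : OpenPartialHomeomorph X ℂ} {Y : Set X} {u v : X → ℝ}

lemma chart_ne_zero_of_ne {X : Type*} [TopologicalSpace X] {φ : OpenPartialHomeomorph X ℂ} {x : X}
    (hx : x ∈ φ.source) (hne : x ≠ φ.symm 0) : φ x ≠ 0 := fun h ↦
  hne (by rw [← h, φ.left_inv hx])

lemma ne_symm_zero_of_chart_ne_zero {X : Type*} [TopologicalSpace X]
    {φ : OpenPartialHomeomorph X ℂ} (hb : closedBall 0 1 ⊆ φ.target) {x : X} (hx : φ x ≠ 0) :
    x ≠ φ.symm 0 := by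
  rintro rfl
  exact hx (φ.right_inv (hb (by simp)))

lemma IsGreenMinorant.sup (hu : IsGreenMinorant φ Y u) (hv : IsGreenMinorant φ Y v) :
    IsGreenMinorant φ Y (u ⊔ v) where
  nonneg x := (hu.nonneg x).trans le_sup_left
  eq_zero x hx := by simp [hu.eq_zero x hx, hv.eq_zero x hx]
  compact_support := by
    obtain ⟨C, hC, h⟩ := hu.compact_support
    obtain ⟨C', hC', h'⟩ := hv.compact_support
    refine ⟨C ∪ C', hC.union hC', fun x hx ↦ ?_⟩
    rw [mem_union, not_or] at hx
    simp [h x hx.1, h' x hx.2]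
  subharmonicAt x hx := (hu.subharmonicAt x hx).sup (hv.subharmonicAt x hx)
  log_bound := by
    obtain ⟨M, hM⟩ := hu.log_bound
    obtain ⟨M', hM'⟩ := hv.log_bound
    refine ⟨max M M', ?_⟩
    filter_upwards [hM, hM'] with x h h'
    rw [Pi.sup_apply, ← le_sub_iff_add_le, sup_le_iff, le_sub_iff_add_le, le_sub_iff_add_le]
    exact ⟨h.trans (le_max_left _ _), h'.trans (le_max_right _ _)⟩

lemma isGreenMinorant_zero (hb : closedBall 0 1 ⊆ φ.target) : IsGreenMinorant φ Y 0 where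
  nonneg _ := le_rfl
  eq_zero _ _ := rfl
  compact_support := ⟨∅, isCompact_empty, fun _ _ ↦ rfl⟩
  subharmonicAt _ _ := subharmonicAt_const 0
  log_bound := by
    refine ⟨0, eventually_nhdsWithin_of_eventually_nhds ?_⟩
    have h0 : (0 : ℂ) ∈ φ.target := hb (by simp)
    have hc := φ.continuousAt (φ.map_target h0)
    rw [ContinuousAt, φ.right_inv h0] at hc
    filter_upwards [hc (ball_mem_nhds _ one_pos)] with x hx
    have : ‖φ x‖ ≤ 1 := by simpa using (ball_subset_closedBall hx)
    simpa using Real.log_nonpos (norm_nonneg _) this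

open Classical in
/-- The Green function of the unit disk of the chart `φ`, extended by zero. -/
noncomputable def diskGreen {X : Type*} [TopologicalSpace X]
    (φ : OpenPartialHomeomorph X ℂ) (x : X) : ℝ :=
  if x ∈ chartPreimage φ (ball 0 1) then -Real.log ‖φ x‖ else 0

lemma diskGreen_nonneg {X : Type*} [TopologicalSpace X] {φ : OpenPartialHomeomorph X ℂ} (x : X) :
    0 ≤ diskGreen φ x := by
  unfold diskGreen
  split_ifs with h
  · have : ‖φ x‖ < 1 := by simpa using h.2
    linarith [Real.log_nonpos (norm_nonneg _) this.le]
  · exact le_rfl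

/-- The Green function of `Y` with pole at the centre of `φ`. -/
noncomputable def greenFunction (φ : OpenPartialHomeomorph X ℂ) (Y : Set X) : X → ℝ :=
  upperEnvelope {v | IsGreenMinorant φ Y v}

lemma greenFunction_eq_zero (hb : closedBall 0 1 ⊆ φ.target) {x : X} (hx : x ∉ Y) :
    greenFunction φ Y x = 0 := by
  have h : (fun v : X → ℝ ↦ v x) '' {v | IsGreenMinorant φ Y v} = {0} := by
    ext a
    constructor
    · rintro ⟨v, hv, rfl⟩
      exact IsGreenMinorant.eq_zero hv x hx
    · rintro rfl
      exact ⟨0, isGreenMinorant_zero hb, rfl⟩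
  rw [greenFunction, upperEnvelope, h, csSup_singleton]

variable [IsManifold 𝓘(ℂ) ω X] [T2Space X]

/-- This competitor forces the envelope to have the full logarithmic pole. Off the pole it is
-log‖φ‖ inside the disk; elsewhere it is zero and, being nonnegative, is touched from below by the
constant 0. -/
lemma isGreenMinorant_diskGreen (hφ : IsHolomorphicChart φ) (hb : closedBall 0 1 ⊆ φ.target)
    (hφY : φ.source ⊆ Y) : IsGreenMinorant φ Y (diskGreen φ) := by
  have hL : ∀ y ∈ φ.source, φ y ≠ 0 → HarmonicNear (fun y ↦ Real.log ‖φ y‖) y := by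
    intro y hy hy0
    simpa using harmonicNear_log_norm hφ hy hy0
  have hcl : IsClosed (chartPreimage φ (closedBall 0 1)) :=
    (isCompact_chartPreimage (isCompact_closedBall 0 1) hb).isClosed
  have hcont : ∀ x, x ≠ φ.symm 0 → ContinuousAt (diskGreen φ) x := by
    intro x hx
    by_cases hxs : x ∈ φ.source
    · have h1 : ContinuousAt (fun y ↦ max (-Real.log ‖φ y‖) 0) x :=
        (hL x hxs (chart_ne_zero_of_ne hxs hx)).continuousAt.neg.max continuousAt_const
      refine h1.congr ?_
      filter_upwards [φ.open_source.mem_nhds hxs,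
        isOpen_ne.mem_nhds hx] with y hy hne
      have hy0 := norm_pos_iff.2 (chart_ne_zero_of_ne hy hne)
      unfold diskGreen
      split_ifs with h
      · have : ‖φ y‖ < 1 := by simpa using h.2
        exact max_eq_left (by linarith [Real.log_nonpos (norm_nonneg _) this.le])
      · have : 1 ≤ ‖φ y‖ := by
          by_contra! h'
          exact h ⟨hy, by simpa using h'⟩
        exact max_eq_right (by linarith [Real.log_nonneg this])
    · have hx' : x ∉ chartPreimage φ (closedBall 0 1) := fun h ↦ hxs h.1
      refine (continuousAt_const (y := (0 : ℝ))).congr ?_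
      filter_upwards [hcl.isOpen_compl.mem_nhds hx'] with y hy
      exact (if_neg fun h ↦ hy ⟨h.1, ball_subset_closedBall h.2⟩).symm
  refine ⟨diskGreen_nonneg, fun x hx ↦ if_neg fun h ↦ hx (hφY h.1),
    ⟨_, isCompact_chartPreimage (isCompact_closedBall 0 1) hb,
      fun x hx ↦ if_neg fun h ↦ hx ⟨h.1, ball_subset_closedBall h.2⟩⟩, fun x hx ↦ ?_, ?_⟩
  · by_cases h : x ∈ chartPreimage φ (ball 0 1)
    · refine (hL x h.1 (chart_ne_zero_of_ne h.1 hx)).neg.subharmonicAt.congr ?_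
      filter_upwards [(isOpen_chartPreimage isOpen_ball).mem_nhds h] with y hy using if_pos hy
    · refine (subharmonicAt_const 0).of_le ?_ (if_neg h)
        (Eventually.of_forall diskGreen_nonneg)
      filter_upwards [isOpen_ne.mem_nhds hx] with y hy using hcont y hy
  · refine ⟨0, eventually_nhdsWithin_of_eventually_nhds ?_⟩
    filter_upwards [(isOpen_chartPreimage isOpen_ball).mem_nhds (symm_mem_chartPreimage
      (φ := φ) (ball_subset_closedBall.trans hb) (mem_ball_self one_pos))] with x hx
    rw [diskGreen, if_pos hx]
    simp

variable [ConnectedSpace X]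

/-- Near the pole v + log‖φ‖ is bounded above, and on the unit circle the logarithm vanishes, so the
maximum principle on the punctured disk applies. -/
lemma IsGreenMinorant.inner_bound (hv : IsGreenMinorant φ Y v) (hφ : IsHolomorphicChart φ)
    (hb : closedBall 0 1 ⊆ φ.target) {m : ℝ} (hm : ∀ x ∈ chartPreimage φ (sphere 0 1), v x ≤ m) :
    ∀ x ∈ chartPreimage φ (closedBall 0 1 \ {0}), v x + Real.log ‖φ x‖ ≤ m := by
  have hL : ∀ y ∈ φ.source, φ y ≠ 0 → HarmonicNear (fun y ↦ Real.log ‖φ y‖) y := by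
    intro y hy hy0
    simpa using harmonicNear_log_norm hφ hy hy0
  have hsub : ∀ y ∈ φ.source, φ y ≠ 0 →
      SubharmonicAt (fun x ↦ v x + Real.log ‖φ x‖ - m) y := fun y hy hy0 ↦
    ((hv.subharmonicAt y (ne_symm_zero_of_chart_ne_zero hb hy0)).add
      (hL y hy hy0).subharmonicAt).sub_const m
  intro x hx
  have := SubharmonicAt.le_zero_of_punctured hφ hb (u := fun x ↦ v x + Real.log ‖φ x‖ - m)
    (fun y hy ↦ (hsub y hy.1 (ne_of_mem_sphere hy.2 one_ne_zero)).continuousAt)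
    (fun y hy ↦ hsub y hy.1 hy.2.2) ?_ (fun y hy ↦ ?_) x hx
  · linarith
  · obtain ⟨M, hM⟩ := hv.log_bound
    exact ⟨M - m, hM.mono fun y hy ↦ by linarith⟩
  · have h1 : ‖φ y‖ = 1 := by simpa using hy.2
    have := hm y hy
    rw [h1, Real.log_one]
    linarith

/-- Compact support replaces a condition at infinity: the maximum principle is applied on the
support with the disk removed. -/
lemma IsGreenMinorant.outer_bound (hv : IsGreenMinorant φ Y v)
    (hb : closedBall 0 1 ⊆ φ.target) {r : ℝ} (hr : 0 < r) (hr1 : r ≤ 1) {m : ℝ} (hm0 : 0 ≤ m)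
    (hm : ∀ x ∈ chartPreimage φ (sphere 0 r), v x ≤ m) :
    ∀ x ∉ chartPreimage φ (ball 0 r), v x ≤ m := by
  obtain ⟨C, hC, hvC⟩ := hv.compact_support
  have hbr : closedBall 0 r ⊆ φ.target := (closedBall_subset_closedBall hr1).trans hb
  have h0 : φ.symm 0 ∈ chartPreimage φ (ball 0 r) :=
    symm_mem_chartPreimage (ball_subset_closedBall.trans hbr) (by simpa using hr)
  have hcl : IsClosed (chartPreimage φ (closedBall 0 r)) :=
    (isCompact_chartPreimage (isCompact_closedBall 0 r) hbr).isClosed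
  have hsub : ∀ x ∉ chartPreimage φ (ball 0 r), SubharmonicAt v x := fun x hx ↦
    hv.subharmonicAt x fun h ↦ hx (h ▸ h0)
  have hbc : chartPreimage φ (ball 0 r) ⊆ chartPreimage φ (closedBall 0 r) :=
    fun x hx ↦ ⟨hx.1, ball_subset_closedBall hx.2⟩
  -- Restricting to v > 0 puts this open set inside C; where v vanishes the bound follows from m ≥
  -- 0.
  have hO : IsOpen ((chartPreimage φ (closedBall 0 r))ᶜ ∩ v ⁻¹' Ioi 0) :=
    ContinuousOn.isOpen_inter_preimage (fun x hx ↦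
      (hsub x fun h ↦ hx (hbc h)).continuousAt.continuousWithinAt) hcl.isOpen_compl isOpen_Ioi
  intro x hx
  by_cases hxC : x ∈ C
  swap
  · rwa [hvC x hxC]
  have := SubharmonicAt.le_zero_of_isCompact (u := fun x ↦ v x - m)
    (S := C \ chartPreimage φ (ball 0 r)) (hC.diff (isOpen_chartPreimage isOpen_ball)) hO
    (fun y hy ↦ ⟨by_contra fun h ↦ (hvC y h).not_gt hy.2, fun h ↦ hy.1 (hbc h)⟩)
    (fun h ↦ ?_) (fun y hy ↦ ((hsub y hy.2).sub_const m).continuousAt.continuousWithinAt)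
    (fun y hy ↦ (hsub y fun h ↦ hy.1 (hbc h)).sub_const m) (fun y hy hyO ↦ ?_) x ⟨hxC, hx⟩
  · linarith
  · have h1 : φ.symm 0 ∈ (chartPreimage φ (closedBall 0 r))ᶜ ∩ v ⁻¹' Ioi 0 := h ▸ mem_univ _
    exact h1.1 (hbc h0)
  · by_cases hyb : y ∈ chartPreimage φ (closedBall 0 r)
    · have : y ∈ chartPreimage φ (sphere 0 r) :=
        ⟨hyb.1, ((ball_union_sphere (x := (0 : ℂ)) (ε := r)).ge hyb.2).resolve_left
          fun h ↦ hy.2 ⟨hyb.1, h⟩⟩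
      linarith [hm y this]
    · have : ¬ 0 < v y := fun h ↦ hyO ⟨hyb, h⟩
      linarith

/-- The uniform bound on the competitors; it needs an open set disjoint from `Y`. -/
theorem exists_green_bound (hφ : IsHolomorphicChart φ) (hb : closedBall 0 1 ⊆ φ.target)
    (hφY : φ.source ⊆ Y) {D : Set X} (hD : IsOpen D) (hDne : D.Nonempty) (hDY : Disjoint D Y) :
    ∃ m, 0 ≤ m ∧ ∀ v, IsGreenMinorant φ Y v →
      (∀ x ∈ chartPreimage φ (closedBall 0 1 \ {0}), v x + Real.log ‖φ x‖ ≤ m) ∧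
      ∀ x ∉ chartPreimage φ (ball 0 1), v x ≤ m := by
  obtain ⟨θ, hθ, hcontr⟩ := exists_contraction hb hD hDne
    fun x hx hxs ↦ hDY.notMem_of_mem_left hx (hφY hxs)
  have hlog : 0 < Real.log 2 := Real.log_pos (by norm_num)
  -- The solution of m = θ(m + log 2), with θ replaced by its positive part so that m ≥ 0.
  set m := max θ 0 * Real.log 2 / (1 - max θ 0) with hmdef
  have hθ1 : max θ 0 < 1 := max_lt hθ one_pos
  have hθ0 : 0 ≤ max θ 0 := le_max_right _ _
  have hm : 0 ≤ m := div_nonneg (by positivity) (by linarith)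
  refine ⟨m, hm, fun v hv ↦ ?_⟩
  suffices h : ∀ x ∈ chartPreimage φ (sphere 0 1), v x ≤ m from
    ⟨hv.inner_bound hφ hb h, hv.outer_bound hb one_pos le_rfl hm h⟩
  have hS : IsCompact (chartPreimage φ (sphere 0 1)) :=
    isCompact_chartPreimage (isCompact_sphere 0 1) (sphere_subset_closedBall.trans hb)
  have hSne : (chartPreimage φ (sphere 0 1)).Nonempty :=
    ⟨φ.symm 1, symm_mem_chartPreimage (sphere_subset_closedBall.trans hb) (by simp)⟩
  obtain ⟨x₁, hx₁, hmax⟩ := hS.exists_isMaxOn hSne fun y hy ↦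
    (hv.subharmonicAt y (ne_symm_zero_of_chart_ne_zero hb
      (ne_of_mem_sphere hy.2 one_ne_zero))).continuousAt.continuousWithinAt
  have hmax' : ∀ x ∈ chartPreimage φ (sphere 0 1), v x ≤ v x₁ := fun x hx ↦ hmax hx
  suffices h : v x₁ ≤ m from fun x hx ↦ (hmax' x hx).trans h
  set b := v x₁ + Real.log 2
  have hbpos : 0 < b := by have := hv.nonneg x₁; positivity
  have h1 : ∀ x ∈ chartPreimage φ (sphere 0 (1 / 2)), v x ≤ b := by
    intro x hx
    have hn : ‖φ x‖ = 1 / 2 := by simpa using hx.2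
    have := hv.inner_bound hφ hb hmax' x ⟨hx.1, by simp [hn]; norm_num, fun h ↦ by
      rw [h, norm_zero] at hn; norm_num at hn⟩
    rw [hn, one_div, Real.log_inv] at this
    linarith
  have h2 := hv.outer_bound hb (by norm_num) (by norm_num) hbpos.le h1
  -- Dividing by b, the bound of v off the half disk, normalizes v for the contraction, which gives
  -- v x₁ ≤ θ(v x₁ + log 2).
  have h3 := hcontr (b⁻¹ • v) (fun x hx ↦ ⟨?_, ?_⟩) (fun x hx ↦ ?_) x₁ hx₁
  · have h4 : v x₁ ≤ max θ 0 * b := by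
      have h5 : b⁻¹ * v x₁ ≤ max θ 0 := h3.trans (le_max_left _ _)
      rwa [inv_mul_le_iff₀ hbpos, mul_comm] at h5
    rw [hmdef, le_div_iff₀ (by linarith)]
    simp only [b] at h4
    linarith
  · refine (hv.subharmonicAt x fun h ↦ hx ?_).const_smul (inv_pos.2 hbpos).le
    rw [h]
    exact symm_mem_chartPreimage ((closedBall_subset_closedBall (by norm_num)).trans hb) (by simp)
  · have h4 := h2 x fun h ↦ hx ⟨h.1, ball_subset_closedBall h.2⟩
    rw [Pi.smul_apply, smul_eq_mul, inv_mul_le_iff₀ hbpos, mul_one]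
    exact h4
  · simp [hv.eq_zero x (hDY.notMem_of_mem_left hx)]

/-- The modification takes place in a compact disk inside Y that misses the pole, so the behaviour
at the pole is unchanged and the support grows only by that disk. -/
lemma IsGreenMinorant.poissonMod (hv : IsGreenMinorant φ Y v)
    {ψ : OpenPartialHomeomorph X ℂ} (hψ : IsHolomorphicChart ψ) (hψb : closedBall 0 1 ⊆ ψ.target)
    (hψY : ψ.source ⊆ Y \ {φ.symm 0}) :
    IsGreenMinorant φ Y (poissonMod ψ v) ∧ v ≤ poissonMod ψ v := by
  have hsub : ∀ x ∈ ψ.source, SubharmonicAt v x := fun x hx ↦ hv.subharmonicAt x (hψY hx).2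
  have hle : v ≤ _root_.poissonMod ψ v := le_poissonMod hψ hψb
    (fun x hx ↦ (hsub x hx.1).continuousAt) (fun x hx ↦ hsub x hx.1)
  refine ⟨⟨fun x ↦ (hv.nonneg x).trans (hle x), fun x hx ↦ ?_, ?_, fun x hx ↦
    (hv.subharmonicAt x hx).poissonMod hψ hψb (fun y hy ↦ hsub y hy.1), ?_⟩, hle⟩
  · rw [poissonMod_of_notMem fun h ↦ hx (hψY h.1).1, hv.eq_zero x hx]
  · obtain ⟨C, hC, h⟩ := hv.compact_support
    refine ⟨C ∪ chartPreimage ψ (closedBall 0 1),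
      hC.union (isCompact_chartPreimage (isCompact_closedBall 0 1) hψb), fun x hx ↦ ?_⟩
    rw [mem_union, not_or] at hx
    rw [poissonMod_of_notMem fun h' ↦ hx.2 ⟨h'.1, ball_subset_closedBall h'.2⟩, h x hx.1]
  · obtain ⟨M, hM⟩ := hv.log_bound
    have h1 : φ.symm 0 ∉ chartPreimage ψ (closedBall 0 1) := fun h ↦ (hψY h.1).2 rfl
    refine ⟨M, ?_⟩
    filter_upwards [hM, eventually_nhdsWithin_of_eventually_nhds
      (poissonMod_eventuallyEq (v := v) hψb h1)] with x h2 h3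
    rwa [h3]

/-- Away from the pole the competitors are uniformly bounded. -/
lemma exists_green_bound_off (hφ : IsHolomorphicChart φ) (hb : closedBall 0 1 ⊆ φ.target)
    (hφY : φ.source ⊆ Y) {D : Set X} (hD : IsOpen D) (hDne : D.Nonempty) (hDY : Disjoint D Y)
    {N : Set X} (hN : N ∈ 𝓝 (φ.symm 0)) :
    ∃ M, 0 ≤ M ∧ ∀ v, IsGreenMinorant φ Y v → ∀ x ∉ N, v x ≤ M := by
  obtain ⟨m, hm, h⟩ := exists_green_bound hφ hb hφY hD hDne hDY
  have h0 : (0 : ℂ) ∈ φ.target := hb (by simp)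
  obtain ⟨δ, hδ, hδN⟩ := Metric.mem_nhds_iff.1 ((φ.continuousAt_symm h0) hN)
  -- Within the unit disk but off N one has ‖φ x‖ ≥ δ, hence v x ≤ m - log δ.
  refine ⟨m + |Real.log δ|, by positivity, fun v hv x hx ↦ ?_⟩
  by_cases hxb : x ∈ chartPreimage φ (ball 0 1)
  · have hδx : δ ≤ ‖φ x‖ := by
      by_contra! h'
      have h2 : φ.symm (φ x) ∈ N := hδN (by simpa using h')
      rw [φ.left_inv hxb.1] at h2
      exact hx h2
    have h1 := (h v hv).1 x ⟨hxb.1, ball_subset_closedBall hxb.2,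
      norm_pos_iff.1 (hδ.trans_le hδx)⟩
    have h2 := Real.log_le_log hδ hδx
    linarith [neg_abs_le (Real.log δ)]
  · linarith [(h v hv).2 x hxb, abs_nonneg (Real.log δ)]

lemma bddAbove_green (hφ : IsHolomorphicChart φ) (hb : closedBall 0 1 ⊆ φ.target)
    (hφY : φ.source ⊆ Y) {D : Set X} (hD : IsOpen D) (hDne : D.Nonempty) (hDY : Disjoint D Y)
    {x : X} (hx : x ≠ φ.symm 0) :
    BddAbove ((fun v : X → ℝ ↦ v x) '' {v | IsGreenMinorant φ Y v}) := by
  obtain ⟨M, -, h⟩ := exists_green_bound_off hφ hb hφY hD hDne hDY (isOpen_ne.mem_nhds hx.symm)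
  refine ⟨M, ?_⟩
  rintro _ ⟨v, hv, rfl⟩
  exact h v hv x (by simp)

theorem isHarmonicOn_greenFunction (hφ : IsHolomorphicChart φ) (hb : closedBall 0 1 ⊆ φ.target)
    (hφY : φ.source ⊆ Y) (hY : IsOpen Y) {D : Set X} (hD : IsOpen D) (hDne : D.Nonempty)
    (hDY : Disjoint D Y) : IsHarmonicOn (greenFunction φ Y) (Y \ {φ.symm 0}) :=
  IsPerronFamily.isHarmonicOn_upperEnvelope
    { nonempty := ⟨0, isGreenMinorant_zero hb⟩
      continuousAt := fun _ hv x hx ↦ (IsGreenMinorant.subharmonicAt hv x hx.2).continuousAt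
      nonneg := fun _ hv x _ ↦ IsGreenMinorant.nonneg hv x
      bddAbove := fun _ hx ↦ bddAbove_green hφ hb hφY hD hDne hDY hx.2
      sup_mem := fun _ hu _ hv ↦ IsGreenMinorant.sup hu hv
      poissonMod_mem := fun _ hψ hψY hψb _ hv ↦ (IsGreenMinorant.poissonMod hv hψ hψb hψY).1
      le_poissonMod := fun _ hψ hψY hψb _ hv ↦ (IsGreenMinorant.poissonMod hv hψ hψb hψY).2 }
    (hY.sdiff isClosed_singleton)

lemma greenFunction_nonneg (hφ : IsHolomorphicChart φ) (hb : closedBall 0 1 ⊆ φ.target)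
    (hφY : φ.source ⊆ Y) {D : Set X} (hD : IsOpen D) (hDne : D.Nonempty)
    (hDY : Disjoint D Y) {x : X} (hx : x ≠ φ.symm 0) : 0 ≤ greenFunction φ Y x :=
  le_upperEnvelope (bddAbove_green hφ hb hφY hD hDne hDY hx)
    (show (0 : X → ℝ) ∈ _ from isGreenMinorant_zero hb)

/-- Near its pole the Green function differs from `-log ‖φ‖` by a bounded function. -/
lemma exists_abs_greenFunction_add_log_le (hφ : IsHolomorphicChart φ)
    (hb : closedBall 0 1 ⊆ φ.target) (hφY : φ.source ⊆ Y) {D : Set X} (hD : IsOpen D)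
    (hDne : D.Nonempty) (hDY : Disjoint D Y) :
    ∃ m, ∀ x ∈ chartPreimage φ (ball 0 1 \ {0}),
      |greenFunction φ Y x + Real.log ‖φ x‖| ≤ m := by
  obtain ⟨m, hm, h⟩ := exists_green_bound hφ hb hφY hD hDne hDY
  refine ⟨m, fun x hx ↦ abs_le.2 ⟨?_, ?_⟩⟩
  · have h1 := le_upperEnvelope (bddAbove_green hφ hb hφY hD hDne hDY
      (ne_symm_zero_of_chart_ne_zero hb hx.2.2))
      (show diskGreen φ ∈ _ from isGreenMinorant_diskGreen hφ hb hφY)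
    rw [diskGreen, if_pos ⟨hx.1, hx.2.1⟩] at h1
    rw [greenFunction]
    linarith
  · rw [← le_sub_iff_add_le]
    refine upperEnvelope_le ⟨0, isGreenMinorant_zero hb⟩ fun v hv ↦ ?_
    linarith [(h v hv).1 x ⟨hx.1, ball_subset_closedBall hx.2.1, hx.2.2⟩]

end GreenFamily

/-! ### Exterior disks and boundary barriers. -/

section Barrier

/-- The derivative is differentiable at q, so it varies there by at most C‖y - q‖; the mean value
inequality on the ball of radius ‖z - q‖ turns this into a quadratic error. -/
lemma exists_taylor_bound {ρ : ℂ → ℝ} {T : Set ℂ} (hT : IsOpen T) {q : ℂ} (hq : q ∈ T)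
    (hρ : ContDiffOn ℝ ∞ ρ T) : ∃ C ≥ 0, ∃ δ > 0, closedBall q δ ⊆ T ∧
      ∀ z ∈ closedBall q δ, |ρ z - ρ q - fderiv ℝ ρ q (z - q)| ≤ C * ‖z - q‖ ^ 2 := by
  have hat : ContDiffAt ℝ ∞ ρ q := hρ.contDiffAt (hT.mem_nhds hq)
  have hd : DifferentiableAt ℝ (fderiv ℝ ρ) q :=
    (hat.fderiv_right (m := 1) (by norm_cast)).differentiableAt one_ne_zero
  obtain ⟨C, hC, hbound⟩ := hd.isBigO_sub.exists_nonneg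
  rw [Asymptotics.isBigOWith_iff] at hbound
  obtain ⟨δ, hδ, h⟩ := Metric.nhds_basis_closedBall.mem_iff.1
    (inter_mem (hT.mem_nhds hq) hbound)
  refine ⟨C, hC, δ, hδ, fun z hz ↦ (h hz).1, fun z hz ↦ ?_⟩
  have hsub : closedBall q ‖z - q‖ ⊆ closedBall q δ :=
    closedBall_subset_closedBall (by simpa [dist_eq_norm] using hz)
  have h1 := Convex.norm_image_sub_le_of_norm_hasFDerivWithin_le' (𝕜 := ℝ) (f := ρ)
    (f' := fderiv ℝ ρ) (φ := fderiv ℝ ρ q) (C := C * ‖z - q‖) (s := closedBall q ‖z - q‖)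
    (fun y hy ↦ ((hρ.differentiableOn (by simp)).differentiableAt
      (hT.mem_nhds (h (hsub hy)).1)).hasFDerivAt.hasFDerivWithinAt)
    (fun y hy ↦ (h (hsub hy)).2.trans
      (mul_le_mul_of_nonneg_left (by simpa [dist_eq_norm] using hy) hC))
    (convex_closedBall _ _) (x := q) (y := z) (mem_closedBall_self (norm_nonneg _))
    (by simp [dist_eq_norm])
  rw [Real.norm_eq_abs] at h1
  linarith [sq ‖z - q‖, mul_assoc C ‖z - q‖ ‖z - q‖]

/-- A sublevel set of a smooth function has exterior tangent disks at its regular boundary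
points. -/
lemma exists_exterior_disk {ρ : ℂ → ℝ} {T : Set ℂ} (hT : IsOpen T) {q : ℂ} (hq : q ∈ T)
    (hρ : ContDiffOn ℝ ∞ ρ T) (h0 : ρ q = 0) (hd : fderiv ℝ ρ q ≠ 0) :
    ∃ c : ℂ, ∃ s > 0, ∃ δ > 0, closedBall q δ ⊆ T ∧ dist q c = s ∧
      ∀ z ∈ closedBall q δ, ρ z ≤ 0 → s ^ 2 + ‖z - q‖ ^ 2 / 2 ≤ ‖z - c‖ ^ 2 := by
  obtain ⟨C, hC, δ, hδ, hδT, h⟩ := exists_taylor_bound hT hq hρ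
  set a : ℂ := (InnerProductSpace.toDual ℝ ℂ).symm (fderiv ℝ ρ q)
  have ha : 0 < ‖a‖ := by simpa [a] using hd
  -- The centre is q + t∇ρ(q). With 2tC ≤ 1/2 the Taylor error consumes at most half of ‖z - q‖²,
  -- and the other half remains as a quantitative gap.
  set t : ℝ := 1 / (4 * (C + 1)) with ht
  have ht0 : 0 < t := by positivity
  have htC : 2 * t * C ≤ 1 / 2 := by
    rw [ht]
    field_simp
    linarith
  refine ⟨q + t • a, t * ‖a‖, by positivity, δ, hδ, hδT, ?_, fun z hz hρz ↦ ?_⟩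
  · simp [dist_eq_norm, abs_of_pos ht0]
  · have h1 := (abs_le.1 (h z hz)).1
    rw [h0] at h1
    have h2 : fderiv ℝ ρ q (z - q) = inner ℝ a (z - q) :=
      (InnerProductSpace.toDual_symm_apply).symm
    have h3 : ‖z - (q + t • a)‖ ^ 2 =
        ‖z - q‖ ^ 2 - 2 * (t * inner ℝ a (z - q)) + (t * ‖a‖) ^ 2 := by
      rw [← sub_sub, norm_sub_sq_real, real_inner_smul_right, norm_smul, Real.norm_eq_abs,
        abs_of_pos ht0, real_inner_comm]
    have h4 : inner ℝ a (z - q) ≤ C * ‖z - q‖ ^ 2 := by rw [← h2]; linarith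
    have h5 := mul_le_mul_of_nonneg_left h4 (by positivity : 0 ≤ 2 * t)
    have h6 := mul_le_mul_of_nonneg_right htC (sq_nonneg ‖z - q‖)
    rw [h3]
    nlinarith

variable {X : Type*} [TopologicalSpace X] [ChartedSpace ℂ X] {K : Set X} {p : X}

/-- The tangent disk is placed on the side where ρ > 0. Although K need not be closed in X, it is
relatively closed in the chart domain, whence the compactness. -/
lemma IsSubsurfaceWithSmoothBoundary.exists_exterior_disk
    (hK : IsSubsurfaceWithSmoothBoundary K) (hp : p ∈ subsurfaceBoundary K) :
    ∃ (ψ : OpenPartialHomeomorph X ℂ) (c : ℂ) (s δ : ℝ), IsHolomorphicChart ψ ∧ p ∈ ψ.source ∧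
      0 < s ∧ 0 < δ ∧ dist (ψ p) c = s ∧ closedBall (ψ p) δ ⊆ ψ.target ∧
      (∀ x ∈ chartPreimage ψ (closedBall (ψ p) δ), x ∈ K →
        s ^ 2 + ‖ψ x - ψ p‖ ^ 2 / 2 ≤ ‖ψ x - c‖ ^ 2) ∧
      ∀ δ' ≤ δ, IsCompact (chartPreimage ψ (closedBall (ψ p) δ') ∩ K) := by
  obtain ⟨ψ, ρ, hψ, hpψ, hρ, hd, hKρ⟩ := hK p hp.1 hp.2
  have hq := ψ.map_source hpψ
  have hρc : ContinuousOn ρ ψ.target := hρ.continuousOn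
  -- A negative value would persist nearby and make p an interior point of K.
  have h0 : ρ (ψ p) = 0 := by
    refine le_antisymm ((hKρ p hpψ).1 hp.1) ?_
    by_contra! hlt
    refine hp.2 (mem_interior_iff_mem_nhds.2 ?_)
    have h1 : ∀ᶠ x in 𝓝 p, ρ (ψ x) < 0 :=
      ((hρc.continuousAt (ψ.open_target.mem_nhds hq)).comp (ψ.continuousAt hpψ)).eventually
        (gt_mem_nhds hlt)
    filter_upwards [h1, ψ.open_source.mem_nhds hpψ] with x hx hxs
    exact (hKρ x hxs).2 hx.le
  obtain ⟨c, s, hs, δ, hδ, hδT, hqc, h⟩ :=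
    _root_.exists_exterior_disk ψ.open_target hq hρ h0 hd
  refine ⟨ψ, c, s, δ, hψ, hpψ, hs, hδ, hqc, hδT,
    fun x hx hxK ↦ h _ hx.2 ((hKρ x hx.1).1 hxK), fun δ' hδ' ↦ ?_⟩
  have hsub : closedBall (ψ p) δ' ⊆ ψ.target :=
    (closedBall_subset_closedBall hδ').trans hδT
  have heq : chartPreimage ψ (closedBall (ψ p) δ') ∩ K =
      chartPreimage ψ (closedBall (ψ p) δ' ∩ ρ ⁻¹' Iic 0) := by
    ext x
    constructor
    · rintro ⟨hx, hxK⟩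
      exact ⟨hx.1, hx.2, (hKρ x hx.1).1 hxK⟩
    · rintro ⟨hx, hxb, hxρ⟩
      exact ⟨⟨hx, hxb⟩, (hKρ x hx).2 hxρ⟩
  rw [heq]
  exact isCompact_chartPreimage ((isCompact_closedBall _ _).of_isClosed_subset
    ((hρc.mono hsub).preimage_isClosed_of_isClosed isClosed_closedBall isClosed_Iic)
    inter_subset_left) (inter_subset_left.trans hsub)

/-- The part of the open exterior disk near a boundary point misses K. This is where a nonempty
boundary is needed: it makes the Green function finite. -/
lemma IsSubsurfaceWithSmoothBoundary.exists_isOpen_disjoint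
    (hK : IsSubsurfaceWithSmoothBoundary K) (hne : (subsurfaceBoundary K).Nonempty) :
    ∃ D : Set X, IsOpen D ∧ D.Nonempty ∧ Disjoint D K := by
  obtain ⟨p, hp⟩ := hne
  obtain ⟨ψ, c, s, δ, -, -, hs, hδ, hqc, hδT, h, -⟩ := hK.exists_exterior_disk hp
  have hcl : ψ p ∈ closure (ball c s) := by
    rw [closure_ball c hs.ne']
    exact hqc.le
  obtain ⟨z, hzδ, hzs⟩ := Metric.mem_closure_iff.1 hcl δ hδ |>.imp fun z hz ↦ And.symm hz
  have hzb : z ∈ ball (ψ p) δ := by rwa [mem_ball, dist_comm]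
  have hsub : ball (ψ p) δ ∩ ball c s ⊆ ψ.target :=
    inter_subset_left.trans (ball_subset_closedBall.trans hδT)
  refine ⟨chartPreimage ψ (ball (ψ p) δ ∩ ball c s),
    isOpen_chartPreimage (isOpen_ball.inter isOpen_ball),
    ⟨ψ.symm z, symm_mem_chartPreimage hsub ⟨hzb, hzs⟩⟩, ?_⟩
  refine Set.disjoint_left.2 fun x hx hxK ↦ ?_
  have h1 := h x ⟨hx.1, ball_subset_closedBall hx.2.1⟩ hxK
  have h2 : ‖ψ x - c‖ < s := by simpa [dist_eq_norm] using hx.2.2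
  nlinarith [sq_nonneg ‖ψ x - ψ p‖, norm_nonneg (ψ x - c)]

variable [IsManifold 𝓘(ℂ) ω X] [T2Space X] [ConnectedSpace X]
  {φ : OpenPartialHomeomorph X ℂ}

/-- The Green function attains the boundary value zero. -/
theorem tendsto_greenFunction_boundary (hK : IsSubsurfaceWithSmoothBoundary K)
    (hφ : IsHolomorphicChart φ) (hb : closedBall 0 1 ⊆ φ.target) (hφK : φ.source ⊆ interior K)
    (hp : p ∈ subsurfaceBoundary K) :
    Tendsto (greenFunction φ (interior K)) (𝓝[K] p) (𝓝 0) := by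
  obtain ⟨D, hD, hDne, hDK⟩ := hK.exists_isOpen_disjoint ⟨p, hp⟩
  have hDY : Disjoint D (interior K) := hDK.mono_right interior_subset
  obtain ⟨ψ, c, s, δ₀, hψ, hpψ, hs, hδ₀, hqc, hδT, h, hcomp⟩ := hK.exists_exterior_disk hp
  have hp0 : p ≠ φ.symm 0 := by
    rintro rfl
    exact hp.2 (hφK (φ.map_target (hb (by simp))))
  obtain ⟨δ, hδ, hδδ, hδ0⟩ : ∃ δ > 0, δ ≤ δ₀ ∧
      φ.symm 0 ∉ chartPreimage ψ (closedBall (ψ p) δ) := by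
    by_cases hx : φ.symm 0 ∈ ψ.source
    · have hpos : 0 < dist (ψ (φ.symm 0)) (ψ p) :=
        dist_pos.2 fun h ↦ hp0 (ψ.injOn hx hpψ h).symm
      refine ⟨min δ₀ (dist (ψ (φ.symm 0)) (ψ p) / 2), by positivity, min_le_left _ _,
        fun h' ↦ ?_⟩
      have h1 : dist (ψ (φ.symm 0)) (ψ p) ≤ _ := h'.2
      linarith [h1.trans (min_le_right _ _)]
    · exact ⟨δ₀, hδ₀, le_rfl, fun h' ↦ hx h'.1⟩
  have hδT' : closedBall (ψ p) δ ⊆ ψ.target := (closedBall_subset_closedBall hδδ).trans hδT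
  set S₀ := chartPreimage ψ (closedBall (ψ p) δ) with hS₀
  have hS₀c : IsClosed S₀ := (isCompact_chartPreimage (isCompact_closedBall _ _) hδT').isClosed
  obtain ⟨M, hM, hvM⟩ := exists_green_bound_off hφ hb hφK hD hDne hDY
    (hS₀c.isOpen_compl.mem_nhds hδ0)
  -- The barrier log(‖ψ - c‖/s): it vanishes at p and is harmonic and nonnegative on K near p.
  set b : X → ℝ := fun x ↦ Real.log ‖ψ x - c‖ - Real.log s with hbdef
  have hge : ∀ x ∈ S₀, x ∈ K → s ^ 2 + ‖ψ x - ψ p‖ ^ 2 / 2 ≤ ‖ψ x - c‖ ^ 2 :=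
    fun x hx hxK ↦ h x ⟨hx.1, closedBall_subset_closedBall hδδ hx.2⟩ hxK
  have hsle : ∀ x ∈ S₀, x ∈ K → s ≤ ‖ψ x - c‖ := fun x hx hxK ↦
    le_of_sq_le_sq (by nlinarith [hge x hx hxK, sq_nonneg ‖ψ x - ψ p‖]) (norm_nonneg _)
  have hb0 : ∀ x ∈ S₀, x ∈ K → 0 ≤ b x := fun x hx hxK ↦
    sub_nonneg.2 (Real.log_le_log hs (hsle x hx hxK))
  -- The lower bound for b on K at distance exactly δ from p, read off from the quadratic gap of the
  -- exterior disk.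
  set η := Real.log (s ^ 2 + δ ^ 2 / 2) / 2 - Real.log s with hη
  have hηpos : 0 < η := by
    have h1 := Real.log_lt_log (by positivity : 0 < s ^ 2)
      (by linarith [sq_pos_of_pos hδ] : s ^ 2 < s ^ 2 + δ ^ 2 / 2)
    rw [Real.log_pow] at h1
    push_cast at h1
    rw [hη]
    linarith
  have hbη : ∀ x ∈ S₀, x ∈ K → ‖ψ x - ψ p‖ = δ → η ≤ b x := by
    intro x hx hxK hxδ
    have h1 := hge x hx hxK
    rw [hxδ] at h1
    have h2 := Real.log_le_log (by positivity) h1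
    rw [Real.log_pow] at h2
    push_cast at h2
    simp only [hη, hbdef]
    linarith
  have hbh : ∀ x ∈ S₀, x ∈ K → HarmonicNear b x := by
    intro x hx hxK
    have h1 : HarmonicNear (fun y ↦ Real.log ‖ψ y - c‖) x :=
      harmonicNear_log_norm hψ hx.1 fun h' ↦ by
        have := hsle x hx hxK
        rw [h', sub_self, norm_zero] at this
        linarith
    have h2 : HarmonicNear (fun _ : X ↦ -Real.log s) x := fun _ _ _ ↦ harmonicAt_const _
    exact h1.add h2
  -- The multiple M/η of b dominates v on the edge of S₀ ∩ K: at distance δ it is at least M, and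
  -- off the interior of K v is zero.
  have key : ∀ v, IsGreenMinorant φ (interior K) v → ∀ x ∈ S₀ ∩ K, v x ≤ M / η * b x := by
    intro v hv x hx
    have hMη : 0 ≤ M / η := div_nonneg hM hηpos.le
    have hvs : ∀ x ∈ S₀, SubharmonicAt v x := fun x hx ↦
      hv.subharmonicAt x fun h' ↦ hδ0 (h' ▸ hx)
    have hneg : ∀ y ∈ S₀ ∩ K, HarmonicNear (-b) y := fun y hy ↦ (hbh y hy.1 hy.2).neg
    have := SubharmonicAt.le_zero_of_isCompact (u := v + (M / η) • -b)
      (S := S₀ ∩ K) (O := chartPreimage ψ (ball (ψ p) δ) ∩ interior K) (hcomp δ hδδ)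
      ((isOpen_chartPreimage isOpen_ball).inter isOpen_interior)
      (fun y hy ↦ ⟨⟨hy.1.1, ball_subset_closedBall hy.1.2⟩, interior_subset hy.2⟩)
      (fun h' ↦ ?_) (fun y hy ↦ ?_) (fun y hy ↦ ?_) (fun y hy hyO ↦ ?_) x hx
    · simp only [Pi.add_apply, Pi.smul_apply, Pi.neg_apply, smul_eq_mul] at this
      linarith
    · have h1 : φ.symm 0 ∈ chartPreimage ψ (ball (ψ p) δ) ∩ interior K := h' ▸ mem_univ _
      exact hδ0 ⟨h1.1.1, ball_subset_closedBall h1.1.2⟩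
    · exact ((hvs y hy.1).continuousAt.add
        ((hneg y hy).continuousAt.const_smul _)).continuousWithinAt
    · have hy' : y ∈ S₀ ∩ K := ⟨⟨hy.1.1, ball_subset_closedBall hy.1.2⟩, interior_subset hy.2⟩
      exact (hvs y hy'.1).add ((hneg y hy').subharmonicAt.const_smul hMη)
    · simp only [Pi.add_apply, Pi.smul_apply, Pi.neg_apply, smul_eq_mul]
      by_cases hyi : y ∈ interior K
      · have hyδ : ‖ψ y - ψ p‖ = δ := by
          have h1 : ‖ψ y - ψ p‖ ≤ δ := by simpa [dist_eq_norm] using hy.1.2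
          refine h1.eq_of_not_lt fun h2 ↦ hyO ⟨⟨hy.1.1, ?_⟩, hyi⟩
          simpa [dist_eq_norm] using h2
        have h1 := mul_le_mul_of_nonneg_left (hbη y hy.1 hy.2 hyδ) hMη
        rw [div_mul_cancel₀ _ hηpos.ne'] at h1
        linarith [hvM v hv y (fun h' ↦ h' hy.1)]
      · rw [hv.eq_zero y hyi]
        linarith [mul_nonneg hMη (hb0 y hy.1 hy.2)]
  have hpS : p ∈ S₀ := ⟨hpψ, mem_closedBall_self hδ.le⟩
  have hlim : Tendsto (fun x ↦ M / η * b x) (𝓝[K] p) (𝓝 0) := by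
    have h1 : Tendsto (fun x ↦ M / η * b x) (𝓝 p) (𝓝 (M / η * b p)) :=
      (hbh p hpS hp.1).continuousAt.const_mul _
    have h2 : b p = 0 := by
      simp only [hbdef]
      rw [← dist_eq_norm, hqc, sub_self]
    rw [h2, mul_zero] at h1
    exact h1.mono_left nhdsWithin_le_nhds
  have hnhds : S₀ ∈ 𝓝 p := by
    filter_upwards [(isOpen_chartPreimage (φ := ψ) isOpen_ball).mem_nhds
      ⟨hpψ, mem_ball_self hδ⟩] with x hx using ⟨hx.1, ball_subset_closedBall hx.2⟩
  refine tendsto_of_tendsto_of_tendsto_of_le_of_le' tendsto_const_nhds hlim ?_ ?_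
  · filter_upwards [mem_nhdsWithin_of_mem_nhds (isOpen_ne.mem_nhds hp0)] with x hx
    exact greenFunction_nonneg hφ hb hφK hD hDne hDY hx
  · filter_upwards [mem_nhdsWithin_of_mem_nhds hnhds, self_mem_nhdsWithin] with x hx hxK
    exact upperEnvelope_le ⟨0, isGreenMinorant_zero hb⟩ fun v hv ↦ key v hv x ⟨hx, hxK⟩

end Barrier

/-! ### Removing the singularity at the pole. -/

section LogarithmicPole

variable {X : Type*} [TopologicalSpace X] [ChartedSpace ℂ X]
  {φ ξ : OpenPartialHomeomorph X ℂ} {x₀ : X}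

/-- The transition map is differentiable and fixes 0, so ‖φ‖ ≤ C‖ξ‖ near x₀. Used in both
directions, it shows that changing the coordinate alters the logarithm by a bounded amount. -/
lemma exists_log_norm_le (hφ : IsHolomorphicChart φ) (hξ : IsHolomorphicChart ξ)
    (hxφ : x₀ ∈ φ.source) (hxξ : x₀ ∈ ξ.source) (hφ0 : φ x₀ = 0) (hξ0 : ξ x₀ = 0) :
    ∃ C, ∀ᶠ x in 𝓝[≠] x₀, Real.log ‖φ x‖ ≤ C + Real.log ‖ξ x‖ := by
  have hs : ξ.symm 0 = x₀ := by rw [← hξ0, ξ.left_inv hxξ]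
  have h0 : (0 : ℂ) ∈ ξ.target := hξ0 ▸ ξ.map_source hxξ
  have ha := hφ.analyticAt_comp_symm hξ h0 (by rwa [hs])
  obtain ⟨C, hC, hbound⟩ := ha.differentiableAt.isBigO_sub.exists_pos
  rw [Asymptotics.isBigOWith_iff] at hbound
  have hc : Tendsto ξ (𝓝 x₀) (𝓝 0) := by
    have := ξ.continuousAt hxξ
    rwa [ContinuousAt, hξ0] at this
  refine ⟨Real.log C, ?_⟩
  filter_upwards [eventually_nhdsWithin_of_eventually_nhds (hc.eventually hbound),
    eventually_nhdsWithin_of_eventually_nhds (φ.open_source.eventually_mem hxφ),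
    eventually_nhdsWithin_of_eventually_nhds (ξ.open_source.eventually_mem hxξ),
    self_mem_nhdsWithin] with x hx hxs hxs' hne
  have h1 : 0 < ‖φ x‖ := norm_pos_iff.2 fun h ↦ hne (φ.injOn hxs hxφ (h.trans hφ0.symm))
  have h2 : 0 < ‖ξ x‖ := norm_pos_iff.2 fun h ↦ hne (ξ.injOn hxs' hxξ (h.trans hξ0.symm))
  simp only [Function.comp_apply, ξ.left_inv hxs', hs, hφ0, sub_zero] at hx
  rw [← Real.log_mul hC.ne' h2.ne']
  exact Real.log_le_log h1 hx

variable [IsManifold 𝓘(ℂ) ω X] [T2Space X] [ConnectedSpace X]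

/-- A function that is harmonic on a punctured neighbourhood and bounded up to a logarithm has a
logarithmic pole: the singularity is removable. -/
theorem hasLogarithmicPole_of_bounded {G : X → ℝ} {W : Set X} (hW : IsOpen W) (hx₀ : x₀ ∈ W)
    (hG : IsHarmonicOn G (W \ {x₀})) (hφ : IsHolomorphicChart φ) (hxφ : x₀ ∈ φ.source)
    (hφ0 : φ x₀ = 0) (hbd : ∃ m, ∀ᶠ x in 𝓝[≠] x₀, |G x + Real.log ‖φ x‖| ≤ m) :
    HasLogarithmicPole G x₀ := by
  intro ξ hξ hxξ hξ0
  obtain ⟨m, hm⟩ := hbd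
  obtain ⟨C₁, hC₁⟩ := exists_log_norm_le hφ hξ hxφ hxξ hφ0 hξ0
  obtain ⟨C₂, hC₂⟩ := exists_log_norm_le hξ hφ hxξ hxφ hξ0 hφ0
  obtain ⟨r, hr, χ, hχ, hxχ, hχs, hχb, hχ1, -⟩ := exists_disk_chart hξ hxξ (hW.mem_nhds hx₀)
  have hχ0 : χ x₀ = 0 := by simp [hχ1]
  have hs : χ.symm 0 = x₀ := by rw [← hχ0, χ.left_inv hxχ]
  have hne : ∀ {x}, x ∈ χ.source → χ x ≠ 0 → x ≠ x₀ := fun _ h h' ↦ h (h' ▸ hχ0)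
  set u : X → ℝ := fun x ↦ G x + Real.log ‖ξ x‖ with hu
  have hWo : IsOpen (W \ {x₀}) := hW.sdiff isClosed_singleton
  have hL : ∀ x ∈ χ.source, x ≠ x₀ → HarmonicNear (fun y ↦ Real.log ‖ξ y‖) x := by
    intro x hx hx0
    have : ξ x ≠ 0 := fun h ↦ hx0 (ξ.injOn (hχs hx).1 hxξ (h.trans hξ0.symm))
    simpa using harmonicNear_log_norm hξ (hχs hx).1 this
  -- Both u and -u are subharmonic off x₀, so u can be compared with H from either side.
  have hsub : ∀ x ∈ χ.source, x ≠ x₀ → SubharmonicAt u x := fun x hx hx0 ↦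
    (hG.subharmonicAt hWo ⟨(hχs hx).2, hx0⟩).add (hL x hx hx0).subharmonicAt
  have hsub' : ∀ x ∈ χ.source, x ≠ x₀ → SubharmonicAt (-u) x := by
    intro x hx hx0
    have : -u = -G + -(fun y ↦ Real.log ‖ξ y‖) := by
      ext y
      simp only [hu, Pi.neg_apply, Pi.add_apply]
      ring
    rw [this]
    exact (hG.neg.subharmonicAt hWo ⟨(hχs hx).2, hx0⟩).add (hL x hx hx0).neg.subharmonicAt
  have hsph : ∀ x ∈ chartPreimage χ (sphere 0 1), ContinuousAt u x := fun x hx ↦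
    (hsub x hx.1 (hne hx.1 (ne_of_mem_sphere hx.2 one_ne_zero))).continuousAt
  -- In the disk H depends only on u on the unit circle, so the value of u at x₀ is irrelevant.
  set H := poissonMod χ u with hH
  have hHh : ∀ x ∈ chartPreimage χ (ball 0 1), HarmonicNear H x := fun x hx ↦
    harmonicNear_poissonMod hχ hχb hsph hx
  have hHc : ∀ x ∈ chartPreimage χ (sphere 0 1), ContinuousAt H x := fun x hx ↦
    continuousAt_poissonMod hχb hsph fun _ ↦ hsph x hx
  have hHs : ∀ x ∈ chartPreimage χ (sphere 0 1), H x = u x := fun x hx ↦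
    poissonMod_of_notMem fun h ↦ (mem_ball.1 h.2).ne (mem_sphere.1 hx.2)
  have hx₀V : x₀ ∈ chartPreimage χ (ball 0 1) := ⟨hxχ, by simp [hχ0]⟩
  have hubd : ∃ M, ∀ᶠ x in 𝓝[≠] x₀, |u x| + |H x| ≤ M := by
    have h1 : ∀ᶠ x in 𝓝 x₀, |H x| < |H x₀| + 1 :=
      (hHh x₀ hx₀V).continuousAt.abs.eventually (gt_mem_nhds (lt_add_one _))
    refine ⟨m + |C₁| + |C₂| + (|H x₀| + 1), ?_⟩
    filter_upwards [hm, hC₁, hC₂, eventually_nhdsWithin_of_eventually_nhds h1] with x h2 h3 h4 h5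
    refine add_le_add (abs_le.2 ?_) h5.le
    obtain ⟨h6, h7⟩ := abs_le.1 h2
    simp only [hu]
    constructor <;> linarith [le_abs_self C₁, le_abs_self C₂, abs_nonneg C₁, abs_nonneg C₂]
  refine ⟨chartPreimage χ (ball 0 1), H, isOpen_chartPreimage isOpen_ball, hx₀V,
    fun x hx ↦ (hχs hx.1).1, isHarmonicOn_of_harmonicNear hHh, ?_⟩
  rintro x ⟨hx, hx0⟩
  have hxb : x ∈ chartPreimage χ (closedBall 0 1 \ {0}) :=
    ⟨hx.1, ball_subset_closedBall hx.2, fun h ↦ hx0 (χ.injOn hx.1 hxχ (h.trans hχ0.symm))⟩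
  obtain ⟨M, hM⟩ := hubd
  refine le_antisymm ?_ ?_
  · have := SubharmonicAt.le_zero_of_punctured (u := -u + H) hχ hχb
      (fun y hy ↦ (hsph y hy).neg.add (hHc y hy))
      (fun y hy ↦ (hsub' y hy.1 (hne hy.1 hy.2.2)).add
        (hHh y ⟨hy.1, hy.2.1⟩).subharmonicAt)
      ⟨M, by
        rw [hs]
        filter_upwards [hM] with y hy
        exact (add_le_add (neg_le_abs (u y)) (le_abs_self (H y))).trans hy⟩
      (fun y hy ↦ by simp [hHs y hy]) x hxb
    simp only [Pi.add_apply, Pi.neg_apply] at this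
    linarith
  · have := SubharmonicAt.le_zero_of_punctured (u := u + -H) hχ hχb
      (fun y hy ↦ (hsph y hy).add (hHc y hy).neg)
      (fun y hy ↦ (hsub y hy.1 (hne hy.1 hy.2.2)).add
        (hHh y ⟨hy.1, hy.2.1⟩).neg.subharmonicAt)
      ⟨M, by
        rw [hs]
        filter_upwards [hM] with y hy
        exact (add_le_add (le_abs_self (u y)) (neg_le_abs (H y))).trans hy⟩
      (fun y hy ↦ by simp [hHs y hy]) x hxb
    simp only [Pi.add_apply, Pi.neg_apply] at this
    linarith

end LogarithmicPole

/-! ### The Green function of a sub-surface with boundary. -/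

theorem mainTheorem6 {X : Type*} [TopologicalSpace X] [T2Space X] [ConnectedSpace X]
    [ChartedSpace ℂ X] [IsManifold 𝓘(ℂ) ω X]
    (K : Set X) (hK : IsSubsurfaceWithSmoothBoundary K) (hne : (subsurfaceBoundary K).Nonempty)
    (x₀ : X) (hx₀ : x₀ ∈ interior K) :
    ∃ G : X → ℝ,
      ContinuousOn G (K \ {x₀}) ∧
      (∀ x ∈ K \ {x₀}, 0 ≤ G x) ∧
      IsHarmonicOn G (interior (K \ {x₀})) ∧
      (∀ x ∈ subsurfaceBoundary K, G x = 0) ∧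
      HasLogarithmicPole G x₀ := by
  obtain ⟨φ, hφ, hxφ, hφK, hb, hφ0⟩ := exists_disk_chart_at x₀ (isOpen_interior.mem_nhds hx₀)
  obtain ⟨D, hD, hDne, hDK⟩ := hK.exists_isOpen_disjoint hne
  have hDY : Disjoint D (interior K) := hDK.mono_right interior_subset
  have hs : φ.symm 0 = x₀ := by rw [← hφ0, φ.left_inv hxφ]
  have hint : interior (K \ {x₀}) = interior K \ {x₀} := by
    rw [sdiff_eq, interior_inter, isClosed_singleton.isOpen_compl.interior_eq, sdiff_eq]
  have hharm := isHarmonicOn_greenFunction hφ hb hφK isOpen_interior hD hDne hDY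
  rw [hs] at hharm
  have hzero : ∀ x ∉ interior K, greenFunction φ (interior K) x = 0 := fun x hx ↦
    greenFunction_eq_zero hb hx
  refine ⟨greenFunction φ (interior K), fun x hx ↦ ?_, fun x hx ↦ ?_, by rwa [hint],
    fun x hx ↦ hzero x hx.2, ?_⟩
  · by_cases hxi : x ∈ interior K
    · exact (hharm.1.continuousAt ((isOpen_interior.sdiff isClosed_singleton).mem_nhds
        ⟨hxi, hx.2⟩)).continuousWithinAt
    -- At a boundary point G is zero by construction, so continuity within K is exactly the barrier
    -- estimate.
    · have := tendsto_greenFunction_boundary hK hφ hb hφK ⟨hx.1, hxi⟩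
      rw [ContinuousWithinAt, hzero x hxi]
      exact this.mono_left (nhdsWithin_mono _ sdiff_subset)
  · exact greenFunction_nonneg hφ hb hφK hD hDne hDY fun h ↦ hx.2 (h.trans hs)
  · refine hasLogarithmicPole_of_bounded isOpen_interior hx₀ hharm hφ hxφ hφ0 ?_
    obtain ⟨m, hm⟩ := exists_abs_greenFunction_add_log_le hφ hb hφK hD hDne hDY
    refine ⟨m, ?_⟩
    have hV : ∀ᶠ x in 𝓝 x₀, x ∈ chartPreimage φ (ball 0 1) :=
      (isOpen_chartPreimage isOpen_ball).eventually_mem ⟨hxφ, by simp [hφ0]⟩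
    filter_upwards [eventually_nhdsWithin_of_eventually_nhds hV, self_mem_nhdsWithin] with x hx hne
    exact hm x ⟨hx.1, hx.2, fun h ↦ hne (φ.injOn hx.1 hxφ (h.trans hφ0.symm))⟩
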